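/- Let $q$ be a prime power, let $B_q(n)$ be the set of subspaces of the space $\mathbb F_q^n$ of column vectors, $B_q(n)_m$ the set of those of dimension $m$, and for a finite set $S$ let $V(S)$ be the complex vector space with basis $S$ and the inner product for which $S$ is orthonormal. Identify $\mathbb F_q^n$ with the vectors of $\mathbb F_q^{n+1}$ with last component $0$, so that $V(B_q(n))\subseteq V(B_q(n+1))$. Put $[k]=1+q+\dots+q^{k-1}$. **Construction of $J_q(n)$.** For $X\in B_q(n)$ let $\widehat X=X+\langle e_{n+1}\rangle\in B_q(n+1)$, and let $\theta_n:V(B_q(n))\to V(B_q(n+1))$ be the linear map sending $X$ to the sum of all $Y\in B_q(n+1)$ with $Y\not\subseteq\mathbb F_q^n$ and $Y\cap\mathbb F_q^n=X$. For a character $\chi:(\mathbb F_q^n,+)\to\mathbb C^*$ and $Y\in B_q(n+1)$ let $$p(\chi)(Y)=\sum_{a\in\mathbb F_q^n}\overline{\chi(a)}\,\begin{pmatrix}I&a\\0&1\end{pmatrix}Y\in V(B_q(n+1)).$$ For $n\ge1$ and $\chi$ nontrivial there is a unique hyperplane $X(\chi)\in B_q(n)_{n-1}$ with $p(\chi)(\widehat{X(\chi)})\ne0$;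 let $M_\chi$ be the $n\times(n-1)$ matrix in column reduced echelon form whose column space is $X(\chi)$, and let $\gamma_{n-1}(\chi):V(B_q(n-1))\to V(B_q(n+1))$ be the linear map $Z\mapsto p(\chi)(\widehat{M_\chi Z})$. The set $J_q(n)$ is the set of all members of the following chains $(x_k,\dots,x_{n-k})$, $x_u\in V(B_q(n)_u)$, in $V(B_q(n))$. For $n=0$ the only chain is $(\{0\})$, and for $n=1$ it is $(\{0\},\mathbb F_q)$. For $n\ge1$ the chains for $n+1$ are: 1. for each chain $(x_k,\dots,x_{n-k})$ for $n$ (with $x_{k-1}=x_{n+1-k}=0$), the chain $y_l=x_l+[l-k]\,\theta_n(x_{l-1})$, $k\le l\le n+1-k$, and, if $k<n-k$, also the chain $z_l=-q^n x_l+q^{l+k-1}[n-l-k+1]\,\theta_n(x_{l-1})$, $k+1\le l\le n-k$; 2. for each chain $(x_k,\dots,x_{n-1-k})$ for $n-1$ and each nontrivial $\chi$, the chain $y_{u+1}=\gamma_{n-1}(\chi)(x_u)$, $k\le u\le n-1-k$. **Theorem.** Let $0\le m\le n/2$, and let $J_q(n,m)=J_q(n)\cap V(B_q(n)_m)$ be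 the set of the vectors of rank $m$ in $J_q(n)$. Then $J_q(n,m)$ is an orthogonal basis of $V(B_q(n)_m)$, and each of its elements is an eigenvector of every element of $\mathrm{End}_{GL(n,q)}(V(B_q(n)_m))$, the algebra of the linear maps commuting with the natural action of $GL(n,q)$. Moreover, this algebra is the Bose–Mesner algebra of the Grassmann scheme, i.e. the span of the maps $A_i$, $0\le i\le m$, that send $X\in B_q(n)_m$ to the sum of all $Y\in B_q(n)_m$ with $\dim(X\cap Y)=m-i$. -/

import Mathlib

open scoped Matrix

namespace Grassmann

noncomputable section

variable (F : Type*) [Field F] [Fintype F]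

/-- `B_q(n)`: the (finite) set of all subspaces of the space of column vectors `F ^ n`. -/
abbrev Bq (n : ℕ) : Type _ := Submodule F (Fin n → F)

instance (n : ℕ) : Fintype (Bq F n) := Fintype.ofFinite _

/-- `B_q(n)_m`: the set of all subspaces of `F ^ n` of dimension `m`. -/
abbrev BqRank (n m : ℕ) : Type _ := {X : Bq F n // Module.finrank F X = m}

instance (n m : ℕ) : Fintype (BqRank F n m) := Fintype.ofFinite _

/-- `V(B_q(n))`: the complex vector space with basis `B_q(n)`. -/
abbrev V (n : ℕ) : Type _ := Bq F n →₀ ℂ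

/-- `V(B_q(n)_m)`: the complex vector space with basis `B_q(n)_m`. -/
abbrev VRank (n m : ℕ) : Type _ := BqRank F n m →₀ ℂ

/-- The inclusion of `V(B_q(n)_m)` in `V(B_q(n))`, sending basis elements to basis elements. -/
def rankIncl (n m : ℕ) : VRank F n m →ₗ[ℂ] V F n :=
  Finsupp.lmapDomain ℂ ℂ Subtype.val

variable {F}

/-- The standard inner product on the vector space with basis `S`, conjugate linear in the first
argument: distinct basis elements are orthogonal and each basis element has length `1`. -/
def stdInner {S : Type*} (v w : S →₀ ℂ) : ℂ :=
  v.sum fun x a => starRingEnd ℂ a * w x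

/-! ### The recursive construction of `J_q(n)` -/

/-- The identification of `F ^ n` with the vectors of `F ^ (n + 1)` whose last component is `0`. -/
def incl (F : Type*) [Field F] (n : ℕ) : (Fin n → F) →ₗ[F] (Fin (n + 1) → F) where
  toFun v := Fin.snoc (α := fun _ => F) v 0
  map_add' v w := by
    ext i
    refine Fin.lastCases ?_ (fun j => ?_) i <;> simp
  map_smul' a v := by
    ext i
    refine Fin.lastCases ?_ (fun j => ?_) i <;> simp

/-- The inclusion of `V(B_q(n))` in `V(B_q(n + 1))`. -/
def vIncl (n : ℕ) : V F n →ₗ[ℂ] V F (n + 1) :=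
  Finsupp.lmapDomain ℂ ℂ (Submodule.map (incl F n))

/-- `X̂`: the span of `X` and the last standard basis vector of `F ^ (n + 1)`. -/
def hat {n : ℕ} (X : Bq F n) : Bq F (n + 1) :=
  X.map (incl F n) ⊔ Submodule.span F {Pi.single (Fin.last n) 1}

/-- `Y ∼ Z` on the set `A_q(n + 1)` of the subspaces of `F ^ (n + 1)` not contained in `F ^ n`:
both subspaces are in this set, and they have the same intersection with `F ^ n`. -/
def Equivalent {n : ℕ} (Y Z : Bq F (n + 1)) : Prop :=
  ¬ Y ≤ LinearMap.range (incl F n) ∧ ¬ Z ≤ LinearMap.range (incl F n) ∧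
    Y.comap (incl F n) = Z.comap (incl F n)

open Classical in
/-- The linear map `θ_n`, which sends a subspace `X` of `F ^ n` to the sum of all `Y ∼ X̂`. -/
def theta (n : ℕ) : V F n →ₗ[ℂ] V F (n + 1) :=
  Finsupp.linearCombination ℂ fun X : Bq F n =>
    ∑ Y : Bq F (n + 1) with Equivalent Y (hat X), Finsupp.single Y (1 : ℂ)

/-- The linear map of `F ^ (n + 1)` with block matrix `[[I, a], [0, 1]]`; for `a` in `F ^ n` these
maps form the group `H(n + 1, q)`. -/
def shear {n : ℕ} (a : Fin n → F) : (Fin (n + 1) → F) →ₗ[F] (Fin (n + 1) → F) :=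
  LinearMap.id + (LinearMap.proj (Fin.last n)).smulRight (incl F n a)

/-- `p(χ)(Y) = ∑_g conj(χ(g)) g Y`, the sum over all `g` in `H(n + 1, q)`, for a character `χ` of
`H(n + 1, q) ≃ F ^ n` and a subspace `Y` of `F ^ (n + 1)`. -/
def charSum {n : ℕ} (χ : AddChar (Fin n → F) ℂ) (Y : Bq F (n + 1)) : V F (n + 1) :=
  ∑ a : Fin n → F, Finsupp.single (Y.map (shear a)) (starRingEnd ℂ (χ a))

/-- Schubert normal form (column reduced echelon form): the first nonzero entry of column `j` is a
`1`, in row `r j`, the `r j` increase strictly, and the rows `r j` form the identity matrix. -/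
def IsSchubert {n k : ℕ} (M : Matrix (Fin n) (Fin k) F) : Prop :=
  ∃ r : Fin k → Fin n, StrictMono r ∧ (∀ j, ∀ i < r j, M i j = 0) ∧ M.submatrix r id = 1

/-- The linear map on `V(B_q(n))` sending a subspace `Z` of `F ^ n` to `p(χ)(Ŷ)`, where
`Y = M Z` is the image of `Z` under the matrix `M`. When `M` is in Schubert normal form with column
space the hyperplane `X` of `F ^ (n + 1)` such that `p(χ)(X̂) ≠ 0`, this is the map `γ_n(χ)`. -/
def gamma {n : ℕ} (χ : AddChar (Fin (n + 1) → F) ℂ) (M : Matrix (Fin (n + 1)) (Fin n) F) :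
    V F n →ₗ[ℂ] V F (n + 2) :=
  Finsupp.linearCombination ℂ fun Z : Bq F n => charSum χ (hat (Z.map M.mulVecLin))

/-- `[k]_q = 1 + q + ⋯ + q ^ (k - 1)`. -/
def qNum (q k : ℕ) : ℂ := ∑ i ∈ Finset.range k, (q : ℂ) ^ i

variable (F) in
/-- Data for a chain `(x_k, …, x_{n - k})` in `V(B_q(n))`: the starting rank `k` and the vectors
`x_u`, with `x_u = 0` for `u` outside `k ≤ u ≤ n - k` in all chains used below. -/
@[ext]
structure Chain (n : ℕ) where
  /-- the rank at which the chain starts -/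
  start : ℕ
  /-- the vector of rank `u` -/
  vec : ℕ → V F n

/-- The chain `y_l = x_l + [l - k] θ(x_{l-1})`, `k ≤ l ≤ n + 1 - k`
(for `l = k` the second term is absent, as `[0] = 0`). -/
def Chain.lower {n : ℕ} (x : Chain F n) : Chain F (n + 1) where
  start := x.start
  vec l :=
    if x.start ≤ l ∧ l + x.start ≤ n + 1 then
      vIncl n (x.vec l) + qNum (Fintype.card F) (l - x.start) • theta n (x.vec (l - 1))
    else 0

/-- The chain `z_l = - q ^ n x_l + q ^ (l + k - 1) [n - l - k + 1] θ(x_{l-1})`,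
`k + 1 ≤ l ≤ n - k`. -/
def Chain.upper {n : ℕ} (x : Chain F n) : Chain F (n + 1) where
  start := x.start + 1
  vec l :=
    if x.start + 1 ≤ l ∧ l + x.start ≤ n then
      (-(Fintype.card F : ℂ) ^ n) • vIncl n (x.vec l) +
        ((Fintype.card F : ℂ) ^ (l + x.start - 1) *
          qNum (Fintype.card F) (n + 1 - (l + x.start))) • theta n (x.vec (l - 1))
    else 0

/-- The chain `y_{u+1} = γ_n(χ)(x_u)`. -/
def Chain.shift {n : ℕ} (χ : AddChar (Fin (n + 1) → F) ℂ) (M : Matrix (Fin (n + 1)) (Fin n) F)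
    (x : Chain F n) : Chain F (n + 2) where
  start := x.start + 1
  vec l := match l with
    | 0 => 0
    | u + 1 => gamma χ M (x.vec u)

variable (F) in
/-- The set of the symmetric Jordan chains that make up `J_q(n)`. -/
def chains : (n : ℕ) → Set (Chain F n)
  | 0 => {⟨0, fun u => if u = 0 then Finsupp.single ⊥ 1 else 0⟩}
  | 1 => {⟨0, fun u => if u = 0 then Finsupp.single ⊥ 1
      else if u = 1 then Finsupp.single ⊤ 1 else 0⟩}
  | n + 2 =>
      {c | ∃ x ∈ chains (n + 1), c = x.lower} ∪
      {c | ∃ x ∈ chains (n + 1), 2 * x.start < n + 1 ∧ c = x.upper} ∪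
      {c | ∃ χ : AddChar (Fin (n + 1) → F) ℂ, χ ≠ 1 ∧
        ∃ M : Matrix (Fin (n + 1)) (Fin n) F, IsSchubert M ∧
          charSum χ (hat (LinearMap.range M.mulVecLin)) ≠ 0 ∧
          ∃ x ∈ chains n, c = x.shift χ M}

variable (F) in
/-- `J_q(n)`: the set of all vectors of the chains constructed above. -/
def Jq (n : ℕ) : Set (V F n) :=
  {v | ∃ c ∈ chains F n, ∃ u, c.start ≤ u ∧ u + c.start ≤ n ∧ v = c.vec u}

variable (F) in
/-- `J_q(n, m)`: the vectors of rank `m` in `J_q(n)`, as elements of `V(B_q(n)_m)`. -/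
def JqRank (n m : ℕ) : Set (VRank F n m) :=
  {v | rankIncl F n m v ∈ Jq F n}

/-! ### The action of `GL(n, q)` and the Bose–Mesner algebra -/

variable (F) in
/-- `GL(n, q)` acts on the `m`-dimensional subspaces of `F ^ n` by taking images. -/
instance glAction (n m : ℕ) : MulAction (GL (Fin n) F) (BqRank F n m) where
  smul g X := ⟨X.1.map (g : Matrix (Fin n) (Fin n) F).mulVecLin, by
    have hg : Function.Injective (g : Matrix (Fin n) (Fin n) F).mulVecLin :=
      Matrix.mulVec_injective_of_isUnit g.isUnit
    exact (Submodule.equivMapOfInjective _ hg X.1).finrank_eq.symm.trans X.2⟩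
  one_smul X := by
    apply Subtype.ext
    change X.1.map ((1 : GL (Fin n) F) : Matrix (Fin n) (Fin n) F).mulVecLin = X.1
    simp
  mul_smul g h X := by
    apply Subtype.ext
    change X.1.map ((g * h : GL (Fin n) F) : Matrix (Fin n) (Fin n) F).mulVecLin =
      (X.1.map (h : Matrix (Fin n) (Fin n) F).mulVecLin).map
        (g : Matrix (Fin n) (Fin n) F).mulVecLin
    rw [← Submodule.map_comp, Units.val_mul, Matrix.mulVecLin_mul]

variable (F) in
/-- The permutation representation of `GL(n, q)` on `V(B_q(n)_m)`. -/
def glRep (n m : ℕ) : Representation ℂ (GL (Fin n) F) (VRank F n m) where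
  toFun g := Finsupp.lmapDomain ℂ ℂ (g • ·)
  map_one' := by
    ext
    simp
  map_mul' g h := by
    ext
    simp [mul_smul]

variable (F) in
/-- `End_{GL(n, q)}(V(B_q(n)_m))`: the linear maps on `V(B_q(n)_m)` that commute with `GL(n, q)`. -/
def commutant (n m : ℕ) : Subalgebra ℂ (Module.End ℂ (VRank F n m)) :=
  Subalgebra.centralizer ℂ (Set.range (glRep F n m))

open Classical in
variable (F) in
/-- The `i`-th association matrix of the Grassmann scheme of `m`-subspaces of `F ^ n`, as a linear
map: it sends `X` to the sum of the `m`-subspaces `Y` with `dim (X ∩ Y) = m - i`. -/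
def assocMap (n m i : ℕ) : Module.End ℂ (VRank F n m) :=
  Finsupp.linearCombination ℂ fun X : BqRank F n m =>
    ∑ Y : BqRank F n m with Module.finrank F ↥(X.1 ⊓ Y.1) + i = m, Finsupp.single Y (1 : ℂ)

variable (F) in
/-- The Bose–Mesner algebra of the Grassmann scheme of `m`-subspaces of `F ^ n`: the span of the
association matrices. -/
def boseMesner (n m : ℕ) : Submodule ℂ (Module.End ℂ (VRank F n m)) :=
  Submodule.span ℂ {A | ∃ i ≤ m, A = assocMap F n m i}

end

end Grassmann

/-!
The up operator `U` sends a subspace to the sum of the subspaces covering it, and the down operator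
`D` is its adjoint. The chains of `J_q(n)` turn out to be symmetric Jordan chains for `U`, pairwise
orthogonal and together spanning `V(B_q(n))`; everything else follows from this.

The shears act on the subspaces of `F ^ (n + 1)` not contained in `F ^ n`, with one orbit for each
subspace `X` of `F ^ n`, namely that of `X̂`, whose stabilizer is `X`. Hence `V(B_q(n + 1))` is the
orthogonal sum of `V(B_q(n))` and the isotypic components of the characters `χ`, and that of `χ` is
spanned by the orthogonal vectors `p(χ)(X̂)` with `χ` trivial on `X` (`stdInner_charSum_hat`,
`eq_top_of_vIncl_of_charSum`). As `χ` is a linear form followed by a character of `F`, for `χ ≠ 1`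
these are the `X` contained in a hyperplane, so that `γ(χ)` identifies `V(B_q(n - 1))` with the
component of `χ`; it commutes with `U` and scales inner products rank by rank (`up_gamma`,
`stdInner_gamma`). For `χ = 1` the component is `θ(V(B_q(n)))`, with `U θ = q θ U` and
`U x = U_n x + θ(x)` for `x` in `V(B_q(n))` (`up_theta`, `up_vIncl`).

From these relations the Jordan property and orthogonality pass from `n - 1` and `n` to `n + 1`.
The only delicate point is that the two chains obtained from one chain are orthogonal. It amounts to
the formula for `|x_{u+1}| ^ 2 / |x_u| ^ 2` recorded in `IsJordan`, which is therefore carried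
through the induction (`IsJordan.lower`, `IsJordan.upper`, `IsJordan.shift`,
`IsJordan.stdInner_lower_upper`). The chains span because the vectors of rank `l` in the two chains
of `x` determine `x_l` and `θ(x_{l-1})`, by a nonzero `2 × 2` determinant (`span_Jq`).

The group `GL(n, q)` is transitive on the pairs of `m`-subspaces with given dimension of the
intersection (`exists_smul_eq_and`), so its commutant is the span of the association matrices `A_i`.
As `D` is the adjoint of `U` and `J_q(n)` is an orthogonal basis of Jordan chains, `D` maps each
vector of a chain to a multiple of the preceding one (`exists_down_vec`), and each vector of
`J_q(n)` is an eigenvector of `U ^ r D ^ r`. On rank `m` this operator is a combination of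
`A_0, …, A_r` with nonzero coefficient at `A_r` (`upDown_single_apply_ne_zero`), and induction on
`r` shows that the vectors of `J_q(n, m)` are eigenvectors of every `A_r`.
-/

namespace Grassmann

open Module

noncomputable section

/-! ### The standard inner product -/

section Inner

theorem stdInner_single_left {S : Type*} (x : S) (a : ℂ) (w : S →₀ ℂ) :
    stdInner (Finsupp.single x a) w = starRingEnd ℂ a * w x := by
  classical
  simp [stdInner, Finsupp.sum_single_index]

variable {S S' : Type*} [Fintype S] [Fintype S']

theorem stdInner_eq_sum (v w : S →₀ ℂ) : stdInner v w = ∑ x, starRingEnd ℂ (v x) * w x :=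
  Finsupp.sum_fintype _ _ (by simp)

theorem stdInner_add_left (u v w : S →₀ ℂ) :
    stdInner (u + v) w = stdInner u w + stdInner v w := by
  simp [stdInner_eq_sum, add_mul, Finset.sum_add_distrib]

theorem stdInner_add_right (u v w : S →₀ ℂ) :
    stdInner u (v + w) = stdInner u v + stdInner u w := by
  simp [stdInner_eq_sum, mul_add, Finset.sum_add_distrib]

theorem stdInner_smul_left (a : ℂ) (v w : S →₀ ℂ) :
    stdInner (a • v) w = starRingEnd ℂ a * stdInner v w := by
  simp [stdInner_eq_sum, Finset.mul_sum, mul_assoc]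

theorem stdInner_smul_right (a : ℂ) (v w : S →₀ ℂ) :
    stdInner v (a • w) = a * stdInner v w := by
  simp [stdInner_eq_sum, Finset.mul_sum, mul_left_comm]

@[simp] theorem stdInner_zero_left (w : S →₀ ℂ) : stdInner 0 w = 0 := by
  simp [stdInner_eq_sum]

@[simp] theorem stdInner_zero_right (v : S →₀ ℂ) : stdInner v 0 = 0 := by
  simp [stdInner_eq_sum]

theorem stdInner_sum_left {ι : Type*} (s : Finset ι) (f : ι → S →₀ ℂ) (w : S →₀ ℂ) :
    stdInner (∑ i ∈ s, f i) w = ∑ i ∈ s, stdInner (f i) w := by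
  classical
  induction s using Finset.induction_on with
  | empty => simp
  | insert a s ha ih => simp [Finset.sum_insert ha, stdInner_add_left, ih]

theorem stdInner_sum_right {ι : Type*} (s : Finset ι) (f : ι → S →₀ ℂ) (v : S →₀ ℂ) :
    stdInner v (∑ i ∈ s, f i) = ∑ i ∈ s, stdInner v (f i) := by
  classical
  induction s using Finset.induction_on with
  | empty => simp
  | insert a s ha ih => simp [Finset.sum_insert ha, stdInner_add_right, ih]

theorem star_stdInner (v w : S →₀ ℂ) : starRingEnd ℂ (stdInner v w) = stdInner w v := by
  simp [stdInner_eq_sum, mul_comm]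

theorem stdInner_eq_zero_symm {v w : S →₀ ℂ} (h : stdInner v w = 0) : stdInner w v = 0 := by
  rw [← star_stdInner, h, map_zero]

theorem stdInner_self_eq_zero {v : S →₀ ℂ} : stdInner v v = 0 ↔ v = 0 := by
  refine ⟨fun h => ?_, fun h => by simp [h]⟩
  have h' : ∑ x, Complex.normSq (v x) = 0 := by
    have : ((∑ x, Complex.normSq (v x) : ℝ) : ℂ) = 0 := by
      rw [← h, stdInner_eq_sum]
      push_cast
      exact Finset.sum_congr rfl fun x _ => Complex.normSq_eq_conj_mul_self
    exact_mod_cast this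
  rw [Finset.sum_eq_zero_iff_of_nonneg fun x _ => Complex.normSq_nonneg _] at h'
  ext x
  simpa using h' x (Finset.mem_univ x)

theorem eq_zero_of_stdInner_eq_zero {A : Set (S →₀ ℂ)} (hA : Submodule.span ℂ A = ⊤)
    {w : S →₀ ℂ} (h : ∀ v ∈ A, stdInner v w = 0) : w = 0 := by
  have key : ∀ v ∈ Submodule.span ℂ A, stdInner v w = 0 := by
    intro v hv
    induction hv using Submodule.span_induction with
    | mem v hv => exact h v hv
    | zero => simp
    | add u v _ _ hu hv => simp [stdInner_add_left, hu, hv]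
    | smul a v _ hv => simp [stdInner_smul_left, hv]
  exact stdInner_self_eq_zero.1 (key w (hA ▸ Submodule.mem_top))

theorem eq_sum_single (v : S →₀ ℂ) : v = ∑ x, v x • Finsupp.single x (1 : ℂ) := by
  simp [Finsupp.univ_sum_single]

/-- If two linear maps send the standard basis to vectors whose inner products are those of the
basis, up to factors `c x`, and `c` is constant on the support of `v`, then they multiply the inner
product of `v` and `w` by that constant. -/
theorem stdInner_map_map [DecidableEq S] (f g : (S →₀ ℂ) →ₗ[ℂ] (S' →₀ ℂ)) (c : S → ℂ)
    (h : ∀ x y, stdInner (f (Finsupp.single x 1)) (g (Finsupp.single y 1)) =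
      if x = y then c x else 0)
    (c₀ : ℂ) (v w : S →₀ ℂ) (hv : ∀ x, v x ≠ 0 → c x = c₀) :
    stdInner (f v) (g w) = c₀ * stdInner v w := by
  conv_lhs => rw [eq_sum_single v, eq_sum_single w]
  simp only [map_sum, map_smul, stdInner_sum_left, stdInner_sum_right, stdInner_smul_left,
    stdInner_smul_right, h]
  rw [stdInner_eq_sum, Finset.mul_sum]
  refine Finset.sum_congr rfl fun x _ => ?_
  simp only [mul_ite, mul_zero, Finset.sum_ite_eq', Finset.mem_univ, if_true]
  by_cases hx : v x = 0
  · simp [hx]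
  · rw [hv x hx]
    ring

theorem stdInner_map_map_eq_zero {T : Type*} [Fintype T] (f : (S →₀ ℂ) →ₗ[ℂ] (S' →₀ ℂ))
    (g : (T →₀ ℂ) →ₗ[ℂ] (S' →₀ ℂ))
    (h : ∀ x y, stdInner (f (Finsupp.single x 1)) (g (Finsupp.single y 1)) = 0)
    (v : S →₀ ℂ) (w : T →₀ ℂ) : stdInner (f v) (g w) = 0 := by
  rw [eq_sum_single v, eq_sum_single w]
  simp only [map_sum, map_smul, stdInner_sum_left, stdInner_sum_right, stdInner_smul_left,
    stdInner_smul_right, h, mul_zero, Finset.sum_const_zero]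

/-- Pairwise orthogonal nonzero vectors are linearly independent. -/
theorem linearIndepOn_of_pairwise_stdInner {A : Set (S →₀ ℂ)}
    (hA : A.Pairwise fun v w => stdInner v w = 0) (h0 : ∀ v ∈ A, v ≠ 0) :
    LinearIndepOn ℂ id A := by
  classical
  rw [LinearIndepOn, linearIndependent_iff']
  intro s g hg i hi
  have h1 : stdInner (i : S →₀ ℂ) (∑ j ∈ s, g j • id (j : S →₀ ℂ)) = 0 := by rw [hg]; simp
  rw [stdInner_sum_right, Finset.sum_eq_single i] at h1
  · simp only [id, stdInner_smul_right, mul_eq_zero, stdInner_self_eq_zero] at h1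
    exact h1.resolve_right (h0 i i.2)
  · intro j _ hj
    rw [stdInner_smul_right]
    simp [hA i.2 j.2 fun h => hj (Subtype.ext h).symm]
  · exact fun h => absurd hi h

end Inner

/-! ### Subspaces of `F ^ n` and of `F ^ (n + 1)` -/

variable {F : Type*} [Field F]

section Subspaces

variable {n : ℕ}

@[simp] theorem incl_last (v : Fin n → F) : incl F n v (Fin.last n) = 0 := by simp [incl]

@[simp] theorem incl_castSucc (v : Fin n → F) (i : Fin n) : incl F n v i.castSucc = v i := by
  simp [incl]

@[simp] theorem init_incl (v : Fin n → F) : Fin.init (incl F n v) = v := by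
  ext i
  simp [Fin.init]

theorem incl_injective : Function.Injective (incl F n) := fun v w h => by
  rw [← init_incl v, h, init_incl]

theorem eq_incl_init {v : Fin (n + 1) → F} (hv : v (Fin.last n) = 0) :
    v = incl F n (Fin.init v) := by
  ext i
  refine Fin.lastCases ?_ (fun j => ?_) i
  · simp [hv]
  · simp [Fin.init]

theorem mem_range_incl {v : Fin (n + 1) → F} :
    v ∈ LinearMap.range (incl F n) ↔ v (Fin.last n) = 0 := by
  refine ⟨?_, fun h => ⟨_, (eq_incl_init h).symm⟩⟩
  rintro ⟨w, rfl⟩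
  simp

theorem mem_map_incl {X : Bq F n} {v : Fin (n + 1) → F} :
    v ∈ X.map (incl F n) ↔ v (Fin.last n) = 0 ∧ Fin.init v ∈ X := by
  constructor
  · rintro ⟨w, hw, rfl⟩
    simpa using hw
  · rintro ⟨h0, hv⟩
    exact ⟨_, hv, (eq_incl_init h0).symm⟩

theorem eq_incl_init_add (v : Fin (n + 1) → F) :
    v = incl F n (Fin.init v) + v (Fin.last n) • Pi.single (Fin.last n) 1 := by
  ext i
  refine Fin.lastCases ?_ (fun j => ?_) i
  · simp
  · simp [Fin.init]

theorem mem_hat {X : Bq F n} {v : Fin (n + 1) → F} : v ∈ hat X ↔ Fin.init v ∈ X := by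
  rw [hat, Submodule.mem_sup]
  constructor
  · rintro ⟨y, hy, z, hz, rfl⟩
    obtain ⟨c, rfl⟩ := Submodule.mem_span_singleton.1 hz
    have : Fin.init (y + c • Pi.single (Fin.last n) (1 : F)) = Fin.init y := by
      ext i
      simp [Fin.init]
    rw [this]
    exact (mem_map_incl.1 hy).2
  · intro h
    exact ⟨_, Submodule.mem_map_of_mem h, _,
      Submodule.smul_mem _ _ (Submodule.mem_span_singleton_self _), (eq_incl_init_add v).symm⟩

@[simp] theorem incl_mem_hat {X : Bq F n} {v : Fin n → F} : incl F n v ∈ hat X ↔ v ∈ X := by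
  simp [mem_hat]

theorem single_last_mem_hat (X : Bq F n) : Pi.single (Fin.last n) (1 : F) ∈ hat X := by
  rw [mem_hat]
  convert X.zero_mem using 1
  ext i
  simp [Fin.init]

@[simp] theorem comap_incl_hat (X : Bq F n) : (hat X).comap (incl F n) = X := by
  ext v
  simp

@[simp] theorem comap_incl_map_incl (X : Bq F n) : (X.map (incl F n)).comap (incl F n) = X :=
  Submodule.comap_map_eq_of_injective incl_injective X

theorem hat_comap_incl {Y : Bq F (n + 1)} (hY : Pi.single (Fin.last n) (1 : F) ∈ Y) :
    hat (Y.comap (incl F n)) = Y := by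
  ext v
  rw [mem_hat, Submodule.mem_comap]
  conv_rhs => rw [eq_incl_init_add v]
  exact (Y.add_mem_iff_left (Y.smul_mem _ hY)).symm

theorem hat_le_hat {X X' : Bq F n} : hat X ≤ hat X' ↔ X ≤ X' := by
  refine ⟨fun h v hv => ?_, fun h v hv => mem_hat.2 (h (mem_hat.1 hv))⟩
  exact incl_mem_hat.1 (h (incl_mem_hat.2 hv))

theorem not_hat_le_range (X : Bq F n) : ¬ hat X ≤ LinearMap.range (incl F n) := fun h => by
  simpa using mem_range_incl.1 (h (single_last_mem_hat X))

theorem finrank_map_incl (X : Bq F n) : finrank F (X.map (incl F n)) = finrank F X :=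
  (Submodule.equivMapOfInjective _ incl_injective X).finrank_eq.symm

theorem finrank_hat (X : Bq F n) : finrank F (hat X) = finrank F X + 1 := by
  have h := Submodule.finrank_sup_add_finrank_inf_eq (X.map (incl F n))
    (Submodule.span F {Pi.single (Fin.last n) (1 : F)})
  have hinf : X.map (incl F n) ⊓ Submodule.span F {Pi.single (Fin.last n) (1 : F)} = ⊥ := by
    rw [eq_bot_iff]
    rintro v ⟨h1, h2⟩
    obtain ⟨c, rfl⟩ := Submodule.mem_span_singleton.1 h2
    have := (mem_map_incl.1 h1).1
    simp at this
    simp [this]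
  rw [hinf, finrank_bot, finrank_map_incl, finrank_span_singleton (by simp)] at h
  exact h

/-! ### Shears -/

theorem shear_apply (a : Fin n → F) (v : Fin (n + 1) → F) :
    shear a v = v + v (Fin.last n) • incl F n a := by
  simp [shear]

@[simp] theorem shear_apply_last (a : Fin n → F) (v : Fin (n + 1) → F) :
    shear a v (Fin.last n) = v (Fin.last n) := by
  simp [shear_apply]

theorem shear_shear (a b : Fin n → F) (v : Fin (n + 1) → F) :
    shear a (shear b v) = shear (a + b) v := by
  rw [shear_apply, shear_apply_last, shear_apply, shear_apply, map_add, smul_add]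
  abel

theorem shear_zero : shear (0 : Fin n → F) = LinearMap.id := by
  ext1
  simp [shear]

theorem mem_map_shear {a : Fin n → F} {Y : Bq F (n + 1)} {v : Fin (n + 1) → F} :
    v ∈ Y.map (shear a) ↔ shear (-a) v ∈ Y := by
  constructor
  · rintro ⟨w, hw, rfl⟩
    rw [shear_shear, neg_add_cancel, shear_zero]
    exact hw
  · intro h
    exact ⟨_, h, by rw [shear_shear, add_neg_cancel, shear_zero]; rfl⟩

theorem map_shear_map_shear (a b : Fin n → F) (Y : Bq F (n + 1)) :
    (Y.map (shear b)).map (shear a) = Y.map (shear (a + b)) := by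
  ext v
  rw [mem_map_shear, mem_map_shear, mem_map_shear, shear_shear, neg_add_rev]

theorem map_shear_zero (Y : Bq F (n + 1)) : Y.map (shear 0) = Y := by
  rw [shear_zero, Submodule.map_id]

theorem shear_injective (a : Fin n → F) : Function.Injective (shear a) :=
  Function.LeftInverse.injective (g := shear (-a)) fun v => by
    rw [shear_shear, neg_add_cancel, shear_zero]
    rfl

theorem comap_incl_map_shear (a : Fin n → F) (Y : Bq F (n + 1)) :
    (Y.map (shear a)).comap (incl F n) = Y.comap (incl F n) := by
  ext v
  rw [Submodule.mem_comap, mem_map_shear, shear_apply]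
  simp

theorem map_shear_le_range {a : Fin n → F} {Y : Bq F (n + 1)} :
    Y.map (shear a) ≤ LinearMap.range (incl F n) ↔ Y ≤ LinearMap.range (incl F n) := by
  constructor
  · intro h v hv
    rw [mem_range_incl, ← shear_apply_last a v]
    exact mem_range_incl.1 (h (Submodule.mem_map_of_mem hv))
  · rintro h _ ⟨v, hv, rfl⟩
    rw [mem_range_incl, shear_apply_last]
    exact mem_range_incl.1 (h hv)

/-- A subspace not contained in `F ^ n` is a shear of `X̂`, with `X` its intersection with
`F ^ n`. -/
theorem exists_map_shear_hat_eq {Y : Bq F (n + 1)} (hY : ¬ Y ≤ LinearMap.range (incl F n)) :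
    ∃ a, (hat (Y.comap (incl F n))).map (shear a) = Y := by
  obtain ⟨w, hwY, hw⟩ := Set.not_subset.1 hY
  have hw0 : w (Fin.last n) ≠ 0 := fun h => hw (mem_range_incl.2 h)
  -- a vector of `Y` with last component `1`
  set v := (w (Fin.last n))⁻¹ • w with hv
  have hvY : v ∈ Y := Y.smul_mem _ hwY
  have hv1 : v (Fin.last n) = 1 := by simp [hv, hw0]
  refine ⟨Fin.init v, ?_⟩
  rw [← comap_incl_map_shear (-Fin.init v) Y, hat_comap_incl, map_shear_map_shear, add_neg_cancel,
    map_shear_zero]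
  rw [mem_map_shear, neg_neg, shear_apply]
  convert hvY using 1
  conv_rhs => rw [eq_incl_init_add v, hv1, one_smul]
  simp [add_comm]

theorem map_shear_hat_eq_iff {a b : Fin n → F} {X X' : Bq F n} :
    (hat X).map (shear a) = (hat X').map (shear b) ↔ X = X' ∧ a - b ∈ X := by
  have key : ∀ c : Fin n → F, c ∈ X → (hat X).map (shear c) = hat X := by
    intro c hc
    have h := hat_comap_incl (Y := (hat X).map (shear c)) ?_
    · rw [← h, comap_incl_map_shear, comap_incl_hat]
    · rw [mem_map_shear, shear_apply]
      refine (hat X).add_mem (single_last_mem_hat X) ?_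
      simpa using hc
  constructor
  · intro h
    have hX : X = X' := by
      rw [← comap_incl_hat X, ← comap_incl_map_shear a, h, comap_incl_map_shear, comap_incl_hat]
    subst hX
    refine ⟨rfl, ?_⟩
    have h1 : shear a (Pi.single (Fin.last n) (1 : F)) ∈ (hat X).map (shear b) :=
      h ▸ Submodule.mem_map_of_mem (single_last_mem_hat X)
    rw [mem_map_shear, shear_shear, shear_apply,
      (hat X).add_mem_iff_right (single_last_mem_hat X)] at h1
    rwa [Pi.single_eq_same, one_smul, incl_mem_hat, neg_add_eq_sub] at h1
  · rintro ⟨rfl, h⟩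
    conv_lhs => rw [show a = b + (a - b) by abel]
    rw [← map_shear_map_shear, key _ h]

theorem finrank_map_shear (a : Fin n → F) (Y : Bq F (n + 1)) :
    finrank F (Y.map (shear a)) = finrank F Y :=
  (Submodule.equivMapOfInjective _ (shear_injective a) Y).finrank_eq.symm

theorem equivalent_hat_iff {X : Bq F n} {Y : Bq F (n + 1)} :
    Equivalent Y (hat X) ↔ ¬ Y ≤ LinearMap.range (incl F n) ∧ Y.comap (incl F n) = X := by
  simp [Equivalent, not_hat_le_range]

theorem finrank_comap_incl_add_one {Y : Bq F (n + 1)} (hY : ¬ Y ≤ LinearMap.range (incl F n)) :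
    finrank F (Y.comap (incl F n)) + 1 = finrank F Y := by
  obtain ⟨a, ha⟩ := exists_map_shear_hat_eq hY
  rw [← finrank_hat, ← finrank_map_shear a, ha]

end Subspaces

variable [Fintype F]

set_option linter.unusedSectionVars false

/-! ### Up and down operators -/

section UpDown

variable {n : ℕ}

/-- `Y` covers `X`: it contains `X`, and its dimension is larger by one. -/
def Covers {F : Type*} [Field F] {n : ℕ} (X Y : Bq F n) : Prop :=
  X ≤ Y ∧ finrank F Y = finrank F X + 1

variable (F n) in
open Classical in
/-- The up operator, which sends a subspace to the sum of the subspaces that cover it. -/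
def up : V F n →ₗ[ℂ] V F n :=
  Finsupp.linearCombination ℂ fun X : Bq F n =>
    ∑ Y : Bq F n with Covers X Y, Finsupp.single Y (1 : ℂ)

variable (F n) in
open Classical in
/-- The down operator, which sends a subspace to the sum of the subspaces that it covers. -/
def down : V F n →ₗ[ℂ] V F n :=
  Finsupp.linearCombination ℂ fun X : Bq F n =>
    ∑ Y : Bq F n with Covers Y X, Finsupp.single Y (1 : ℂ)

open Classical in
theorem up_single (X : Bq F n) :
    up F n (Finsupp.single X 1) = ∑ Y : Bq F n with Covers X Y, Finsupp.single Y (1 : ℂ) := by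
  simp [up]

open Classical in
theorem down_single (X : Bq F n) :
    down F n (Finsupp.single X 1) = ∑ Y : Bq F n with Covers Y X, Finsupp.single Y (1 : ℂ) := by
  simp [down]

theorem sum_filter_single_apply {S : Type*} [Fintype S] (p : S → Prop) [DecidablePred p] (y : S) :
    (∑ x : S with p x, Finsupp.single x (1 : ℂ)) y = if p y then 1 else 0 := by
  classical
  rw [Finsupp.finsetSum_apply, Finset.sum_filter, Finset.sum_eq_single y]
  · simp
  · intro x _ hx
    simp [hx]
  · simp

open Classical in
theorem down_apply (v : V F n) (Z : Bq F n) :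
    down F n v Z = ∑ X : Bq F n with Covers Z X, v X := by
  conv_lhs => rw [eq_sum_single v]
  simp only [map_sum, map_smul, down_single]
  rw [Finsupp.finsetSum_apply, Finset.sum_filter]
  simp only [Finsupp.smul_apply, sum_filter_single_apply, smul_eq_mul, mul_ite, mul_one, mul_zero]

theorem stdInner_up_left (v w : V F n) : stdInner (up F n v) w = stdInner v (down F n w) := by
  classical
  conv_lhs => rw [eq_sum_single v]
  simp only [map_sum, map_smul, stdInner_sum_left, stdInner_smul_left, up_single,
    stdInner_single_left, map_one, one_mul]
  rw [stdInner_eq_sum]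
  exact Finset.sum_congr rfl fun X _ => by rw [down_apply]

theorem stdInner_up_right (v w : V F n) : stdInner v (up F n w) = stdInner (down F n v) w := by
  rw [← star_stdInner, stdInner_up_left, star_stdInner]

variable (F) in
/-- The vectors of rank `u`: the combinations of the `u`-dimensional subspaces. -/
def graded (n u : ℕ) : Submodule ℂ (V F n) :=
  Finsupp.supported ℂ ℂ {X | finrank F X = u}

theorem mem_graded {u : ℕ} {v : V F n} :
    v ∈ graded F n u ↔ ∀ X, v X ≠ 0 → finrank F X = u := by
  simp [graded, Finsupp.mem_supported, Set.subset_def]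

theorem single_mem_graded {u : ℕ} {X : Bq F n} (hX : finrank F X = u) (a : ℂ) :
    Finsupp.single X a ∈ graded F n u :=
  Finsupp.single_mem_supported ℂ a hX

/-- A linear map has degree `d` if it has degree `d` on basis elements. -/
theorem map_mem_graded {n' d : ℕ} (f : V F n →ₗ[ℂ] V F n')
    (h : ∀ X : Bq F n, f (Finsupp.single X 1) ∈ graded F n' (finrank F X + d)) {u : ℕ} {v : V F n}
    (hv : v ∈ graded F n u) : f v ∈ graded F n' (u + d) := by
  rw [eq_sum_single v, map_sum]
  refine Submodule.sum_mem _ fun X _ => ?_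
  rw [map_smul]
  by_cases hX : v X = 0
  · simp [hX]
  · rw [← mem_graded.1 hv X hX]
    exact Submodule.smul_mem _ _ (h X)

theorem stdInner_of_mem_graded {u u' : ℕ} (huu : u ≠ u') {v w : V F n} (hv : v ∈ graded F n u)
    (hw : w ∈ graded F n u') : stdInner v w = 0 := by
  rw [stdInner_eq_sum]
  refine Finset.sum_eq_zero fun X _ => ?_
  by_contra h
  obtain ⟨h1, h2⟩ := not_or.1 (mul_eq_zero.not.1 h)
  exact huu ((mem_graded.1 hv X fun h => h1 (by simp [h])).symm.trans (mem_graded.1 hw X h2))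

end UpDown

/-! ### Character sums -/

section CharSum

variable {n : ℕ}

theorem sum_char_mul_conj (χ χ' : AddChar (Fin n → F) ℂ) [Decidable (χ = χ')] :
    ∑ a, χ a * starRingEnd ℂ (χ' a) = if χ = χ' then (Fintype.card F : ℂ) ^ n else 0 := by
  classical
  have h := AddChar.sum_eq_ite (χ - χ')
  simp only [AddChar.sub_apply, sub_eq_zero] at h
  simp only [← AddChar.map_neg_eq_conj]
  rw [h]
  split_ifs <;> simp

open Classical in
theorem sum_char_subspace (χ : AddChar (Fin n → F) ℂ) (X : Bq F n) :
    ∑ x with x ∈ X, χ x =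
      if ∀ x ∈ X, χ x = 1 then (Fintype.card F : ℂ) ^ finrank F X else 0 := by
  split_ifs with h
  · rw [Finset.sum_congr rfl (g := fun _ => (1 : ℂ)) (by simpa using h)]
    have hc : Fintype.card X = Fintype.card F ^ finrank F X := Module.card_eq_pow_finrank
    rw [Fintype.card_subtype] at hc
    simp [hc]
  · push Not at h
    obtain ⟨x, hx, hχ⟩ := h
    -- translation by `x` multiplies the sum by `χ x`
    have : χ x * ∑ y with y ∈ X, χ y = ∑ y with y ∈ X, χ y := by
      rw [Finset.mul_sum, Finset.sum_filter, Finset.sum_filter]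
      refine Fintype.sum_equiv (Equiv.addLeft x) _ _ fun y => ?_
      simp [X.add_mem_iff_right hx, AddChar.map_add_eq_mul]
    have h0 : (χ x - 1) * ∑ y with y ∈ X, χ y = 0 := by rw [sub_mul, this]; ring
    exact (mul_eq_zero.1 h0).resolve_left (sub_ne_zero.2 hχ)

open Classical in
/-- The vectors `p(χ)(X̂)` are pairwise orthogonal, and `p(χ)(X̂)` vanishes unless `χ` is trivial on
`X`, the stabilizer of `X̂`. -/
theorem stdInner_charSum_hat (χ χ' : AddChar (Fin n → F) ℂ) (X X' : Bq F n) :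
    stdInner (charSum χ (hat X)) (charSum χ' (hat X')) =
      if X = X' then if χ = χ' ∧ ∀ x ∈ X, χ x = 1 then
        (Fintype.card F : ℂ) ^ (n + finrank F X) else 0 else 0 := by
  have key : ∀ a, stdInner (Finsupp.single ((hat X).map (shear a)) (starRingEnd ℂ (χ a)))
      (charSum χ' (hat X')) =
        χ a * ∑ b, if X' = X ∧ b - a ∈ X' then starRingEnd ℂ (χ' b) else 0 := by
    intro a
    simp only [stdInner_single_left, charSum, Finsupp.finsetSum_apply, Finsupp.single_apply,
      map_shear_hat_eq_iff, Complex.conj_conj]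
  rw [charSum, stdInner_sum_left, Finset.sum_congr rfl fun a _ => key a]
  by_cases hX : X = X'
  · subst hX
    have : ∀ a, (χ a * ∑ b, if X = X ∧ b - a ∈ X then starRingEnd ℂ (χ' b) else 0) =
        χ a * starRingEnd ℂ (χ' a) * starRingEnd ℂ (∑ x with x ∈ X, χ' x) := by
      intro a
      rw [Finset.sum_filter, map_sum, Finset.mul_sum, Finset.mul_sum]
      refine Fintype.sum_equiv (Equiv.subRight a) _ _ fun b => ?_
      simp only [Equiv.subRight_apply, true_and]
      split_ifs
      · rw [mul_assoc, ← map_mul, ← AddChar.map_add_eq_mul, add_sub_cancel]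
      · simp
    rw [Finset.sum_congr rfl fun a _ => this a, ← Finset.sum_mul, sum_char_mul_conj,
      sum_char_subspace, if_pos rfl]
    by_cases hχ : χ = χ'
    · subst hχ
      by_cases h : ∀ x ∈ X, χ x = 1
      · rw [if_pos rfl, if_pos h, if_pos ⟨rfl, h⟩]
        simp [pow_add]
      · rw [if_neg h, map_zero, mul_zero]
        exact (if_neg fun h' : χ = χ ∧ _ => h h'.2).symm
    · simp [hχ]
  · have : ∀ a b, ¬ (X' = X ∧ b - a ∈ X') := fun a b h => hX h.1.symm
    simp [hX, this]

theorem charSum_hat_ne_zero_iff {χ : AddChar (Fin n → F) ℂ} {X : Bq F n} :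
    charSum χ (hat X) ≠ 0 ↔ ∀ x ∈ X, χ x = 1 := by
  classical
  have hq : (Fintype.card F : ℂ) ≠ 0 := Nat.cast_ne_zero.2 Fintype.card_ne_zero
  rw [Ne, ← stdInner_self_eq_zero, stdInner_charSum_hat]
  simp [hq]

open Classical in
theorem theta_single (X : Bq F n) : theta n (Finsupp.single X (1 : ℂ)) =
    ∑ Y : Bq F (n + 1) with ¬ Y ≤ LinearMap.range (incl F n) ∧ Y.comap (incl F n) = X,
      Finsupp.single Y (1 : ℂ) := by
  simp [theta, equivalent_hat_iff]

open Classical in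
theorem charSum_apply (χ : AddChar (Fin n → F) ℂ) (Y Y' : Bq F (n + 1)) :
    charSum χ Y Y' = ∑ a, if Y.map (shear a) = Y' then starRingEnd ℂ (χ a) else 0 := by
  simp [charSum, Finsupp.finsetSum_apply, Finsupp.single_apply]

/-- `p(1)(X̂)` is the orbit sum `θ(X)`, times the order of the stabilizer of `X̂`. -/
theorem charSum_one_hat (X : Bq F n) : charSum 1 (hat X) =
    (Fintype.card F : ℂ) ^ finrank F X • theta n (Finsupp.single X 1) := by
  classical
  ext Y
  rw [charSum_apply, theta_single, Finsupp.smul_apply, sum_filter_single_apply]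
  by_cases hY : ¬ Y ≤ LinearMap.range (incl F n) ∧ Y.comap (incl F n) = X
  · obtain ⟨b, hb⟩ := exists_map_shear_hat_eq hY.1
    rw [hY.2] at hb
    subst hb
    rw [if_pos hY]
    have h := sum_char_subspace 1 X
    rw [if_pos (by simp), Finset.sum_filter] at h
    rw [smul_eq_mul, mul_one, ← h]
    refine Fintype.sum_equiv (Equiv.subRight b) _ _ fun a => ?_
    simp [map_shear_hat_eq_iff]
  · rw [if_neg hY, smul_zero]
    refine Finset.sum_eq_zero fun a _ => if_neg ?_
    rintro rfl
    exact hY ⟨by simpa [map_shear_le_range] using not_hat_le_range X,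
      by rw [comap_incl_map_shear, comap_incl_hat]⟩

theorem theta_single_eq (X : Bq F n) : theta n (Finsupp.single X 1) =
    ((Fintype.card F : ℂ) ^ finrank F X)⁻¹ • charSum 1 (hat X) := by
  have hq : (Fintype.card F : ℂ) ≠ 0 := Nat.cast_ne_zero.2 Fintype.card_ne_zero
  rw [charSum_one_hat, inv_smul_smul₀ (pow_ne_zero _ hq)]

theorem vIncl_single (X : Bq F n) (a : ℂ) :
    vIncl n (Finsupp.single X a) = Finsupp.single (X.map (incl F n)) a := by
  simp [vIncl]

theorem gamma_single (χ : AddChar (Fin (n + 1) → F) ℂ) (M : Matrix (Fin (n + 1)) (Fin n) F)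
    (Z : Bq F n) : gamma χ M (Finsupp.single Z 1) = charSum χ (hat (Z.map M.mulVecLin)) := by
  simp [gamma]

/-! ### Inner products in the summands of `V(B_q(n + 1))` -/

theorem stdInner_vIncl (v w : V F n) : stdInner (vIncl n v) (vIncl n w) = stdInner v w := by
  classical
  have h := stdInner_map_map (vIncl (F := F) n) (vIncl n) (fun _ => 1) (fun X Y => ?_) 1 v w
    fun _ _ => rfl
  · rw [h, one_mul]
  · simp only [vIncl_single, stdInner_single_left, Finsupp.single_apply,
      (Submodule.map_injective_of_injective (incl_injective (F := F) (n := n))).eq_iff]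
    simp [eq_comm]

/-- `θ` multiplies inner products by the sizes `q ^ (n - u)` of the orbits. -/
theorem stdInner_theta {u : ℕ} {v : V F n} (hv : v ∈ graded F n u) (hu : u ≤ n) (w : V F n) :
    stdInner (theta n v) (theta n w) = (Fintype.card F : ℂ) ^ (n - u) * stdInner v w := by
  classical
  have hq : (Fintype.card F : ℂ) ≠ 0 := Nat.cast_ne_zero.2 Fintype.card_ne_zero
  refine stdInner_map_map _ _
    (fun X : Bq F n => (Fintype.card F : ℂ) ^ n / (Fintype.card F : ℂ) ^ finrank F X)
    (fun X Y => ?_) _ v w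
    fun X hX => ?_
  · rw [theta_single_eq, theta_single_eq, stdInner_smul_left, stdInner_smul_right,
      stdInner_charSum_hat]
    split_ifs with h h'
    · subst h
      simp only [map_inv₀, map_pow, map_natCast]
      field_simp
      ring
    · simp at h'
    · simp
  · rw [mem_graded.1 hv X hX, eq_comm, eq_div_iff (pow_ne_zero _ hq), ← pow_add,
      Nat.sub_add_cancel hu]

theorem stdInner_vIncl_charSum (v : V F n) (χ : AddChar (Fin n → F) ℂ) (X : Bq F n) :
    stdInner (vIncl n v) (charSum χ (hat X)) = 0 := by
  classical
  rw [eq_sum_single v]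
  simp only [map_sum, map_smul, stdInner_sum_left, stdInner_smul_left, vIncl_single,
    stdInner_single_left, map_one, one_mul, charSum_apply]
  refine Finset.sum_eq_zero fun Y _ => mul_eq_zero_of_right _ <|
    Finset.sum_eq_zero fun a _ => if_neg fun h => ?_
  refine not_hat_le_range X (map_shear_le_range.1 (h.trans_le ?_))
  exact LinearMap.map_le_range

theorem stdInner_vIncl_theta (v w : V F n) : stdInner (vIncl n v) (theta n w) = 0 := by
  rw [eq_sum_single w]
  simp [map_sum, stdInner_sum_right, stdInner_smul_right, theta_single_eq,
    stdInner_vIncl_charSum, -Finsupp.smul_single]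

theorem stdInner_vIncl_gamma (χ : AddChar (Fin (n + 1) → F) ℂ)
    (M : Matrix (Fin (n + 1)) (Fin n) F) (v : V F (n + 1)) (w : V F n) :
    stdInner (vIncl (n + 1) v) (gamma χ M w) = 0 := by
  rw [eq_sum_single w]
  simp [map_sum, stdInner_sum_right, stdInner_smul_right, gamma_single,
    stdInner_vIncl_charSum, -Finsupp.smul_single]

theorem stdInner_theta_gamma {χ : AddChar (Fin (n + 1) → F) ℂ} (hχ : χ ≠ 1)
    (M : Matrix (Fin (n + 1)) (Fin n) F) (v : V F (n + 1)) (w : V F n) :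
    stdInner (theta (n + 1) v) (gamma χ M w) = 0 := by
  classical
  refine stdInner_map_map_eq_zero _ _ (fun X Y => ?_) v w
  rw [theta_single_eq, gamma_single, stdInner_smul_left, stdInner_charSum_hat]
  simp [hχ.symm]

theorem stdInner_gamma_gamma_of_ne {χ χ' : AddChar (Fin (n + 1) → F) ℂ} (hχ : χ ≠ χ')
    (M M' : Matrix (Fin (n + 1)) (Fin n) F) (v w : V F n) :
    stdInner (gamma χ M v) (gamma χ' M' w) = 0 := by
  classical
  refine stdInner_map_map_eq_zero _ _ (fun X Y => ?_) v w
  rw [gamma_single, gamma_single, stdInner_charSum_hat]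
  simp [hχ]

theorem finrank_map_mulVecLin {k : ℕ} {M : Matrix (Fin k) (Fin n) F}
    (hM : Function.Injective M.mulVecLin) (Z : Bq F n) :
    finrank F (Z.map M.mulVecLin) = finrank F Z :=
  (Submodule.equivMapOfInjective _ hM Z).finrank_eq.symm

/-- On the vectors of rank `u`, the map `γ(χ)` multiplies inner products by `q ^ (n + 1 + u)`. -/
theorem stdInner_gamma {χ : AddChar (Fin (n + 1) → F) ℂ} {M : Matrix (Fin (n + 1)) (Fin n) F}
    (hM : Function.Injective M.mulVecLin) (hχ : ∀ x ∈ LinearMap.range M.mulVecLin, χ x = 1)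
    {u : ℕ} {v : V F n} (hv : v ∈ graded F n u) (w : V F n) :
    stdInner (gamma χ M v) (gamma χ M w) = (Fintype.card F : ℂ) ^ (n + 1 + u) * stdInner v w := by
  classical
  refine stdInner_map_map _ _ (fun X : Bq F n => (Fintype.card F : ℂ) ^ (n + 1 + finrank F X))
    (fun X Y => ?_) _ v w fun X hX => by simp [mem_graded.1 hv X hX]
  simp only [gamma_single, stdInner_charSum_hat, finrank_map_mulVecLin hM,
    (Submodule.map_injective_of_injective hM).eq_iff]
  have : ∀ x ∈ X.map M.mulVecLin, χ x = 1 := fun x hx => hχ x (LinearMap.map_le_range hx)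
  rw [if_pos (And.intro trivial this)]

end CharSum

/-! ### The up operator on the summands of `V(B_q(n + 1))` -/

section UpRelations

variable {n : ℕ}

theorem vIncl_mem_graded {u : ℕ} {v : V F n} (hv : v ∈ graded F n u) :
    vIncl n v ∈ graded F (n + 1) u := by
  refine map_mem_graded (d := 0) _ (fun X => ?_) hv
  rw [vIncl_single]
  exact single_mem_graded (finrank_map_incl X) _

theorem charSum_hat_mem_graded (χ : AddChar (Fin n → F) ℂ) (X : Bq F n) :
    charSum χ (hat X) ∈ graded F (n + 1) (finrank F X + 1) :=
  Submodule.sum_mem _ fun _ _ =>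
    single_mem_graded ((finrank_map_shear _ _).trans (finrank_hat X)) _

theorem theta_mem_graded {u : ℕ} {v : V F n} (hv : v ∈ graded F n u) :
    theta n v ∈ graded F (n + 1) (u + 1) := by
  refine map_mem_graded _ (fun X => ?_) hv
  rw [theta_single_eq]
  exact Submodule.smul_mem _ _ (charSum_hat_mem_graded 1 X)

theorem gamma_mem_graded (χ : AddChar (Fin (n + 1) → F) ℂ) {M : Matrix (Fin (n + 1)) (Fin n) F}
    (hM : Function.Injective M.mulVecLin) {u : ℕ} {v : V F n} (hv : v ∈ graded F n u) :
    gamma χ M v ∈ graded F (n + 2) (u + 1) := by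
  refine map_mem_graded _ (fun X => ?_) hv
  rw [gamma_single, ← finrank_map_mulVecLin hM]
  exact charSum_hat_mem_graded χ _

/-- The subspaces covering `X` within `F ^ (n + 1)` are those within `F ^ n`, and the subspaces
occurring in `θ(X)`. -/
theorem up_vIncl (v : V F n) : up F (n + 1) (vIncl n v) = vIncl n (up F n v) + theta n v := by
  classical
  suffices up F (n + 1) ∘ₗ vIncl n = vIncl n ∘ₗ up F n + theta n from LinearMap.congr_fun this v
  refine Finsupp.lhom_ext' fun X => LinearMap.ext_ring ?_
  simp only [LinearMap.comp_apply, Finsupp.lsingle_apply, LinearMap.add_apply, vIncl_single,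
    up_single, theta_single, map_sum]
  rw [← Finset.sum_filter_add_sum_filter_not _ fun Y => Y ≤ LinearMap.range (incl F n)]
  congr 1
  · symm
    refine Finset.sum_nbij' (fun X' => X'.map (incl F n)) (fun Y => Y.comap (incl F n))
      ?_ ?_ ?_ ?_ fun _ _ => rfl
    · intro X' hX'
      simp only [Finset.mem_filter, Finset.mem_univ, true_and] at hX' ⊢
      refine ⟨⟨Submodule.map_mono hX'.1, ?_⟩, LinearMap.map_le_range⟩
      rw [finrank_map_incl, finrank_map_incl, hX'.2]
    · intro Y hY
      simp only [Finset.mem_filter, Finset.mem_univ, true_and] at hY ⊢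
      refine ⟨Submodule.map_le_iff_le_comap.1 hY.1.1, ?_⟩
      rw [← finrank_map_incl, Submodule.map_comap_eq, inf_eq_right.2 hY.2, hY.1.2,
        finrank_map_incl]
    · exact fun X' _ => comap_incl_map_incl X'
    · intro Y hY
      rw [Submodule.map_comap_eq, inf_eq_right.2 (Finset.mem_filter.1 hY).2]
  · rw [Finset.filter_filter]
    refine Finset.sum_congr (Finset.filter_congr fun Y _ => ?_) fun _ _ => rfl
    constructor
    · rintro ⟨h1, h2⟩
      refine ⟨h2, (Submodule.eq_of_le_of_finrank_eq (Submodule.map_le_iff_le_comap.1 h1.1) ?_).symm⟩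
      have h3 := finrank_comap_incl_add_one h2
      have h4 := h1.2
      rw [finrank_map_incl] at h4
      omega
    · rintro ⟨h1, rfl⟩
      refine ⟨⟨Submodule.map_comap_le _ _, ?_⟩, h1⟩
      rw [finrank_map_incl, finrank_comap_incl_add_one h1]

open Classical in
/-- The subspaces covering a shear of `X̂` are the same shear of `X̂'`, for `X'` covering `X`. -/
theorem up_single_map_shear_hat (a : Fin n → F) (X : Bq F n) :
    up F (n + 1) (Finsupp.single ((hat X).map (shear a)) 1) =
      ∑ X' : Bq F n with Covers X X', Finsupp.single ((hat X').map (shear a)) 1 := by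
  rw [up_single]
  symm
  have inv : ∀ Y : Bq F (n + 1), (hat X).map (shear a) ≤ Y →
      (hat (Y.comap (incl F n))).map (shear a) = Y := by
    intro Y hY
    have h : Pi.single (Fin.last n) (1 : F) ∈ Y.map (shear (-a)) := by
      rw [mem_map_shear, neg_neg]
      exact hY (Submodule.mem_map_of_mem (single_last_mem_hat X))
    rw [← comap_incl_map_shear (-a) Y, hat_comap_incl h, map_shear_map_shear, add_neg_cancel,
      map_shear_zero]
  refine Finset.sum_nbij' (fun X' => (hat X').map (shear a)) (fun Y => Y.comap (incl F n))
    ?_ ?_ ?_ ?_ fun _ _ => rfl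
  · intro X' hX'
    simp only [Finset.mem_filter, Finset.mem_univ, true_and] at hX' ⊢
    refine ⟨Submodule.map_mono (hat_le_hat.2 hX'.1), ?_⟩
    rw [finrank_map_shear, finrank_map_shear, finrank_hat, finrank_hat, hX'.2]
  · intro Y hY
    simp only [Finset.mem_filter, Finset.mem_univ, true_and] at hY ⊢
    have h := hY.2
    rw [← inv Y hY.1, finrank_map_shear, finrank_map_shear, finrank_hat, finrank_hat] at h
    refine ⟨?_, Nat.succ_injective h⟩
    have := Submodule.comap_mono (f := incl F n) hY.1
    rwa [comap_incl_map_shear, comap_incl_hat] at this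
  · intro X' _
    rw [comap_incl_map_shear, comap_incl_hat]
  · intro Y hY
    exact inv Y (Finset.mem_filter.1 hY).2.1

open Classical in
/-- The map `X ↦ p(χ)(X̂)` commutes with the up operators. -/
theorem up_charSum_hat (χ : AddChar (Fin n → F) ℂ) (X : Bq F n) :
    up F (n + 1) (charSum χ (hat X)) = ∑ X' : Bq F n with Covers X X', charSum χ (hat X') := by
  have h : ∀ (Y : Bq F (n + 1)) (c : ℂ), Finsupp.single Y c = c • Finsupp.single Y (1 : ℂ) := by
    simp
  simp only [charSum]
  rw [Finset.sum_comm, map_sum]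
  refine Finset.sum_congr rfl fun a _ => ?_
  rw [h, map_smul, up_single_map_shear_hat, Finset.smul_sum]
  exact Finset.sum_congr rfl fun X' _ => (h _ _).symm

theorem up_theta (v : V F n) :
    up F (n + 1) (theta n v) = (Fintype.card F : ℂ) • theta n (up F n v) := by
  classical
  have hq : (Fintype.card F : ℂ) ≠ 0 := Nat.cast_ne_zero.2 Fintype.card_ne_zero
  suffices up F (n + 1) ∘ₗ theta n = (Fintype.card F : ℂ) • (theta n ∘ₗ up F n) from
    LinearMap.congr_fun this v
  refine Finsupp.lhom_ext' fun X => LinearMap.ext_ring ?_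
  simp only [LinearMap.comp_apply, Finsupp.lsingle_apply, LinearMap.smul_apply]
  rw [theta_single_eq, map_smul, up_charSum_hat, up_single, map_sum, Finset.smul_sum,
    Finset.smul_sum]
  refine Finset.sum_congr rfl fun X' hX' => ?_
  rw [charSum_one_hat, smul_smul, (Finset.mem_filter.1 hX').2.2, pow_succ, inv_mul_cancel_left₀]
  exact pow_ne_zero _ hq

/-- A nontrivial character which is trivial on a hyperplane is trivial on no subspace outside of
it. -/
theorem le_of_char_eq_one {χ : AddChar (Fin (n + 1) → F) ℂ} (hχ : χ ≠ 1) {H X : Bq F (n + 1)}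
    (hH : finrank F H = n) (hχH : ∀ x ∈ H, χ x = 1) (hχX : ∀ x ∈ X, χ x = 1) : X ≤ H := by
  by_contra hX
  have hlt : H < H ⊔ X := lt_of_le_of_ne le_sup_left fun h => hX (h ▸ le_sup_right)
  have h1 := Submodule.finrank_lt_finrank_of_lt hlt
  have h2 : H ⊔ X = ⊤ := by
    apply Submodule.eq_top_of_finrank_eq
    have := Submodule.finrank_le (H ⊔ X)
    rw [finrank_fin_fun] at this ⊢
    omega
  refine hχ (DFunLike.ext _ _ fun x => ?_)
  obtain ⟨y, hy, z, hz, rfl⟩ := Submodule.mem_sup.1 (h2 ▸ Submodule.mem_top : x ∈ H ⊔ X)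
  rw [AddChar.map_add_eq_mul, hχH y hy, hχX z hz, AddChar.one_apply, one_mul]

theorem finrank_range_mulVecLin {k : ℕ} {M : Matrix (Fin k) (Fin n) F}
    (hM : Function.Injective M.mulVecLin) : finrank F (LinearMap.range M.mulVecLin) = n := by
  rw [LinearMap.finrank_range_of_inj hM, finrank_fin_fun]

theorem up_gamma {χ : AddChar (Fin (n + 1) → F) ℂ} {M : Matrix (Fin (n + 1)) (Fin n) F}
    (hM : Function.Injective M.mulVecLin) (hχ : χ ≠ 1)
    (hχM : ∀ x ∈ LinearMap.range M.mulVecLin, χ x = 1) (v : V F n) :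
    up F (n + 2) (gamma χ M v) = gamma χ M (up F n v) := by
  classical
  suffices up F (n + 2) ∘ₗ gamma χ M = gamma χ M ∘ₗ up F n from LinearMap.congr_fun this v
  refine Finsupp.lhom_ext' fun Z => LinearMap.ext_ring ?_
  simp only [LinearMap.comp_apply, Finsupp.lsingle_apply]
  rw [gamma_single, up_charSum_hat, up_single, map_sum]
  symm
  refine Finset.sum_of_injOn (fun Z' => Z'.map M.mulVecLin)
    (Submodule.map_injective_of_injective hM).injOn ?_ ?_ fun Z' _ => gamma_single χ M Z'
  · intro Z' hZ'
    simp only [Finset.coe_filter, Finset.mem_univ, true_and, Set.mem_ofPred_eq] at hZ' ⊢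
    refine ⟨Submodule.map_mono hZ'.1, ?_⟩
    rw [finrank_map_mulVecLin hM, finrank_map_mulVecLin hM, hZ'.2]
  · -- the subspaces not contained in the column space of `M` contribute nothing
    intro X hX hX'
    by_contra h0
    have hle := le_of_char_eq_one hχ (finrank_range_mulVecLin hM) hχM
      (charSum_hat_ne_zero_iff.1 h0)
    have hX2 : (X.comap M.mulVecLin).map M.mulVecLin = X := by
      rw [Submodule.map_comap_eq, inf_eq_right.2 hle]
    refine hX' ⟨X.comap M.mulVecLin, ?_, hX2⟩
    simp only [Finset.coe_filter, Finset.mem_univ, true_and, Set.mem_ofPred_eq, Finset.mem_filter]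
      at hX ⊢
    refine ⟨Submodule.map_le_iff_le_comap.1 hX.1, ?_⟩
    rw [← finrank_map_mulVecLin hM, hX2, hX.2, finrank_map_mulVecLin hM]

end UpRelations

/-! ### Matrices in Schubert normal form and the hyperplane of a character -/

section Schubert

theorem submatrix_mulVec {n k : ℕ} {M : Matrix (Fin n) (Fin k) F} {r : Fin k → Fin n}
    (hM : M.submatrix r id = 1) (w : Fin k → F) (j : Fin k) : (M *ᵥ w) (r j) = w j := by
  have : (M.submatrix r id *ᵥ w) j = w j := by rw [hM, Matrix.one_mulVec]
  exact this

theorem IsSchubert.injective {n k : ℕ} {M : Matrix (Fin n) (Fin k) F} (hM : IsSchubert M) :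
    Function.Injective M.mulVecLin := by
  obtain ⟨r, -, -, h⟩ := hM
  intro v w hvw
  ext j
  rw [← submatrix_mulVec h v j, ← submatrix_mulVec h w j]
  exact congr_fun hvw (r j)

/-- In the column space of a matrix in Schubert normal form with pivots `r`, the first nonzero
entry of a nonzero vector is at a pivot. -/
theorem exists_pivot {n k : ℕ} {M : Matrix (Fin n) (Fin k) F} {r : Fin k → Fin n}
    (h0 : ∀ j, ∀ i < r j, M i j = 0) (h1 : M.submatrix r id = 1)
    {v : Fin n → F} (hv : v ∈ LinearMap.range M.mulVecLin) {i : Fin n} (hi : v i ≠ 0)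
    (hlt : ∀ i' < i, v i' = 0) : i ∈ Set.range r := by
  obtain ⟨w, rfl⟩ := hv
  by_contra hri
  -- the coefficients of the columns with pivot before `i` vanish, the other columns vanish at `i`
  refine hi ?_
  rw [Matrix.mulVecLin_apply, Matrix.mulVec, dotProduct]
  refine Finset.sum_eq_zero fun j _ => ?_
  rcases lt_trichotomy (r j) i with h | h | h
  · have := hlt _ h
    rw [Matrix.mulVecLin_apply, submatrix_mulVec h1] at this
    simp [this]
  · exact absurd ⟨j, h⟩ hri
  · simp [h0 j i h]

/-- A matrix in Schubert normal form is determined by its column space. -/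
theorem IsSchubert.eq_of_range_eq {n k : ℕ} {M M' : Matrix (Fin n) (Fin k) F} (hM : IsSchubert M)
    (hM' : IsSchubert M')
    (h : LinearMap.range M.mulVecLin = LinearMap.range M'.mulVecLin) : M = M' := by
  obtain ⟨r, hr, h0, h1⟩ := hM
  obtain ⟨r', hr', h0', h1'⟩ := hM'
  have col_mem : ∀ (N : Matrix (Fin n) (Fin k) F) (j : Fin k),
      N.col j ∈ LinearMap.range N.mulVecLin := fun N j => ⟨Pi.single j 1, by simp⟩
  have sub : ∀ {N N' : Matrix (Fin n) (Fin k) F} {s s' : Fin k → Fin n},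
      (∀ j, ∀ i < s j, N i j = 0) → N.submatrix s id = 1 → (∀ j, ∀ i < s' j, N' i j = 0) →
      N'.submatrix s' id = 1 → LinearMap.range N.mulVecLin = LinearMap.range N'.mulVecLin →
      Set.range s' ⊆ Set.range s := by
    rintro N N' s s' hN0 hN1 hN0' hN1' hNN _ ⟨j, rfl⟩
    refine exists_pivot hN0 hN1 (v := N'.col j) (hNN ▸ col_mem N' j) ?_ fun i hi => hN0' j i hi
    have := congr_fun (congr_fun hN1' j) j
    simp only [Matrix.submatrix_apply, id, Matrix.one_apply_eq] at this
    simp [this]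
  have hrr : r = r' := (StrictMono.range_inj hr hr').1
    (Set.Subset.antisymm (sub h0' h1' h0 h1 h.symm) (sub h0 h1 h0' h1' h))
  subst hrr
  ext i j
  obtain ⟨w, hw⟩ : M'.col j ∈ LinearMap.range M.mulVecLin := h ▸ col_mem M' j
  have hw' : w = Pi.single j 1 := by
    ext l
    rw [← submatrix_mulVec h1 w l]
    have h2 := congr_fun hw (r l)
    have h3 := congr_fun (congr_fun h1' l) j
    rw [Matrix.mulVecLin_apply] at h2
    rw [h2]
    simpa [Matrix.one_apply, Pi.single_apply] using h3
  subst hw'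
  simpa using congr_fun hw i

/-- Every hyperplane is the column space of a matrix in Schubert normal form. -/
theorem exists_isSchubert {n : ℕ} (f : (Fin (n + 1) → F) →ₗ[F] F) (hf : f ≠ 0) :
    ∃ M : Matrix (Fin (n + 1)) (Fin n) F, IsSchubert M ∧
      LinearMap.range M.mulVecLin = LinearMap.ker f := by
  classical
  set c : Fin (n + 1) → F := fun i => f (Pi.single i 1) with hc
  have hfc : ∀ v, f v = ∑ i, v i * c i := by
    intro v
    conv_lhs => rw [pi_eq_sum_univ' v]
    simp [hc, map_sum]
  have hne : (Finset.univ.filter fun i => c i ≠ 0).Nonempty := by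
    by_contra h
    rw [Finset.not_nonempty_iff_eq_empty, Finset.filter_eq_empty_iff] at h
    refine hf (LinearMap.ext fun v => ?_)
    rw [hfc]
    exact Finset.sum_eq_zero fun i hi => by simp [not_not.1 (h hi)]
  -- the only row without a pivot is the last one whose coefficient in `f` does not vanish
  obtain ⟨p, hp, hmax⟩ := Finset.exists_max_image _ id hne
  have hp0 : c p ≠ 0 := (Finset.mem_filter.1 hp).2
  have hlast : ∀ i, p < i → c i = 0 := by
    intro i hi
    by_contra h
    exact absurd (hmax i (by simp [h])) (not_le.2 hi)
  obtain ⟨M, hMdef⟩ : ∃ M : Matrix (Fin (n + 1)) (Fin n) F, ∀ i j, M i j =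
      if i = p.succAbove j then 1 else if i = p then -(c (p.succAbove j) / c p) else 0 :=
    ⟨fun i j => _, fun i j => rfl⟩
  have hpiv : M.submatrix p.succAbove id = 1 := by
    ext i j
    simp [hMdef, Matrix.one_apply, Fin.succAbove_ne, (Fin.succAbove_right_injective).eq_iff]
  have hM : IsSchubert M := by
    refine ⟨p.succAbove, Fin.strictMono_succAbove p, fun j i hi => ?_, hpiv⟩
    rw [hMdef, if_neg hi.ne]
    split_ifs with h
    · subst h
      simp [hlast _ hi]
    · rfl
  refine ⟨M, hM, Submodule.eq_of_le_of_finrank_eq ?_ ?_⟩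
  · rintro _ ⟨w, rfl⟩
    rw [LinearMap.mem_ker, hfc, Fin.sum_univ_succAbove _ p]
    have h1 : ∀ j, (M.mulVecLin w) (p.succAbove j) = w j := submatrix_mulVec hpiv w
    have h2 : (M.mulVecLin w) p = ∑ j, -(c (p.succAbove j) / c p) * w j := by
      simp [hMdef, Matrix.mulVec, dotProduct, (Fin.succAbove_ne p _).symm]
    rw [h2, Finset.sum_mul, ← Finset.sum_add_distrib]
    exact Finset.sum_eq_zero fun j _ => by rw [h1 j]; field_simp; ring
  · rw [finrank_range_mulVecLin hM.injective]
    have h1 := LinearMap.finrank_range_add_finrank_ker f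
    rw [LinearMap.range_eq_top.2 (LinearMap.surjective hf), finrank_top, finrank_self,
      finrank_fin_fun] at h1
    omega

/-- Every character of `F ^ n` is the composite of a linear form and a fixed nontrivial character
of `F`. -/
theorem exists_char_eq_comp (n : ℕ) (χ : AddChar (Fin n → F) ℂ) :
    ∃ (ψ : AddChar F ℂ) (f : (Fin n → F) →ₗ[F] F), ∀ x, χ x = ψ (f x) := by
  classical
  obtain ⟨ψ, hψ⟩ := (AddChar.exists_apply_ne_zero (α := F) (a := 1)).2 one_ne_zero
  let Φ : ((Fin n → F) →ₗ[F] F) → AddChar (Fin n → F) ℂ := fun f =>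
    ψ.compAddMonoidHom f.toAddMonoidHom
  -- both sides have `q ^ n` elements
  have hΦ : Function.Injective Φ := by
    intro f g hfg
    by_contra hne
    obtain ⟨y, hy⟩ := LinearMap.surjective (sub_ne_zero.2 hne) 1
    have h := DFunLike.congr_fun hfg y
    simp only [Φ, AddChar.compAddMonoidHom_apply, LinearMap.toAddMonoidHom_coe] at h
    have hy' : f y = g y + 1 := by
      rw [LinearMap.sub_apply] at hy
      rw [← hy]
      ring
    rw [hy', AddChar.map_add_eq_mul] at h
    exact hψ (mul_left_cancel₀ (ψ.val_isUnit _).ne_zero (h.trans (mul_one _).symm))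
  have : Finite ((Fin n → F) →ₗ[F] F) := Module.finite_of_finite F
  have := Fintype.ofFinite ((Fin n → F) →ₗ[F] F)
  have hcard : Fintype.card ((Fin n → F) →ₗ[F] F) = Fintype.card (AddChar (Fin n → F) ℂ) := by
    rw [AddChar.card_eq, Module.card_eq_pow_finrank (K := F), Module.finrank_linearMap_self]
    simp
  obtain ⟨f, hf⟩ := ((Fintype.bijective_iff_injective_and_card Φ).2 ⟨hΦ, hcard⟩).2 χ
  exact ⟨ψ, f, fun x => (DFunLike.congr_fun hf x).symm⟩

/-- A nontrivial character is trivial on a hyperplane, here the column space of a matrix in Schubert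
normal form. -/
theorem exists_isSchubert_of_ne_one {n : ℕ} {χ : AddChar (Fin (n + 1) → F) ℂ} (hχ : χ ≠ 1) :
    ∃ M : Matrix (Fin (n + 1)) (Fin n) F, IsSchubert M ∧
      ∀ x ∈ LinearMap.range M.mulVecLin, χ x = 1 := by
  obtain ⟨ψ, f, hf⟩ := exists_char_eq_comp _ χ
  have hf0 : f ≠ 0 := by
    rintro rfl
    exact hχ (DFunLike.ext _ _ fun x => by simp [hf])
  obtain ⟨M, hM, hr⟩ := exists_isSchubert f hf0
  refine ⟨M, hM, fun x hx => ?_⟩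
  rw [hr, LinearMap.mem_ker] at hx
  rw [hf, hx, AddChar.map_zero_eq_one]

/-- The matrix in Schubert normal form used in `γ(χ)` is determined by `χ`. -/
theorem eq_of_isSchubert_of_char {n : ℕ} {χ : AddChar (Fin (n + 1) → F) ℂ} (hχ : χ ≠ 1)
    {M M' : Matrix (Fin (n + 1)) (Fin n) F} (hM : IsSchubert M) (hM' : IsSchubert M')
    (h : ∀ x ∈ LinearMap.range M.mulVecLin, χ x = 1)
    (h' : ∀ x ∈ LinearMap.range M'.mulVecLin, χ x = 1) : M = M' :=
  hM.eq_of_range_eq hM' <| le_antisymm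
    (le_of_char_eq_one hχ (finrank_range_mulVecLin hM'.injective) h' h)
    (le_of_char_eq_one hχ (finrank_range_mulVecLin hM.injective) h h')

end Schubert

/-! ### `q`-numbers -/

@[simp] theorem qNum_zero (q : ℕ) : qNum q 0 = 0 := by simp [qNum]

theorem qNum_one (q : ℕ) : qNum q 1 = 1 := by simp [qNum]

theorem qNum_add (q a b : ℕ) : qNum q (a + b) = qNum q a + (q : ℂ) ^ a * qNum q b := by
  simp [qNum, Finset.sum_range_add, pow_add, Finset.mul_sum]

theorem qNum_succ (q k : ℕ) : qNum q (k + 1) = qNum q k + (q : ℂ) ^ k := by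
  rw [qNum_add, qNum_one, mul_one]

theorem qNum_succ' (q k : ℕ) : qNum q (k + 1) = 1 + (q : ℂ) * qNum q k := by
  rw [add_comm, qNum_add, qNum_one, pow_one]

@[simp] theorem conj_qNum (q k : ℕ) : starRingEnd ℂ (qNum q k) = qNum q k := by simp [qNum]

theorem qNum_succ_ne_zero (q k : ℕ) : qNum q (k + 1) ≠ 0 := by
  have : qNum q (k + 1) = ((1 + q * ∑ i ∈ Finset.range k, q ^ i : ℕ) : ℂ) := by
    rw [qNum_succ', qNum]
    push_cast
    rfl
  rw [this, Nat.cast_ne_zero]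
  omega

/-! ### Symmetric Jordan chains -/

/-- A symmetric Jordan chain with respect to the up operator: the vectors `x_k, …, x_{n - k}` have
the ranks given by their indices, the up operator sends each to the next one and the last one to
`0`, and the ratios of the squared lengths are
`|x_{k+j+1}| ^ 2 = q ^ k [j + 1] [n - 2 k - j] |x_{k+j}| ^ 2`. -/
structure IsJordan {n : ℕ} (c : Chain F n) : Prop where
  start_le : 2 * c.start ≤ n
  mem_graded : ∀ u, c.vec u ∈ graded F n u
  eq_zero : ∀ u, ¬ (c.start ≤ u ∧ u + c.start ≤ n) → c.vec u = 0
  start_ne_zero : c.vec c.start ≠ 0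
  up_vec : ∀ j, up F n (c.vec (c.start + j)) = c.vec (c.start + j + 1)
  norm_vec : ∀ j i, 2 * c.start + j + i = n →
    stdInner (c.vec (c.start + j + 1)) (c.vec (c.start + j + 1)) =
      (Fintype.card F : ℂ) ^ c.start * qNum (Fintype.card F) (j + 1) * qNum (Fintype.card F) i *
        stdInner (c.vec (c.start + j)) (c.vec (c.start + j))

theorem IsJordan.vec_ne_zero {n : ℕ} {c : Chain F n} (hc : IsJordan c) {u : ℕ}
    (h1 : c.start ≤ u) (h2 : u + c.start ≤ n) : c.vec u ≠ 0 := by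
  obtain ⟨j, rfl⟩ := Nat.exists_eq_add_of_le h1
  have hq : (Fintype.card F : ℂ) ≠ 0 := Nat.cast_ne_zero.2 Fintype.card_ne_zero
  clear h1
  induction j with
  | zero => exact hc.start_ne_zero
  | succ j ih =>
    obtain ⟨i, hi⟩ := Nat.exists_eq_add_of_le h2
    rw [Ne, ← stdInner_self_eq_zero, ← add_assoc, hc.norm_vec j (i + 1) (by omega)]
    refine mul_ne_zero (mul_ne_zero (mul_ne_zero (pow_ne_zero _ hq) (qNum_succ_ne_zero _ _))
      (qNum_succ_ne_zero _ _)) ?_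
    rw [Ne, stdInner_self_eq_zero]
    exact ih (by omega)

section Step

variable {n : ℕ} {x : Chain F n}

theorem IsJordan.lower_vec_start (hx : IsJordan x) :
    x.lower.vec x.start = vIncl n (x.vec x.start) := by
  have := hx.start_le
  rw [Chain.lower]
  simp only
  rw [if_pos ⟨le_rfl, by omega⟩]
  simp

theorem IsJordan.lower_vec (hx : IsJordan x) (j : ℕ) : x.lower.vec (x.start + j + 1) =
    vIncl n (x.vec (x.start + j + 1)) +
      qNum (Fintype.card F) (j + 1) • theta n (x.vec (x.start + j)) := by
  rw [Chain.lower]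
  simp only
  split_ifs with h
  · rw [show x.start + j + 1 - x.start = j + 1 by omega, Nat.add_sub_cancel]
  · rw [hx.eq_zero (x.start + j + 1) (by omega), hx.eq_zero (x.start + j) (by omega)]
    simp

theorem IsJordan.upper_vec (hx : IsJordan x) (j : ℕ) : x.upper.vec (x.start + j + 1) =
    (-(Fintype.card F : ℂ) ^ n) • vIncl n (x.vec (x.start + j + 1)) +
      ((Fintype.card F : ℂ) ^ (2 * x.start + j) *
        qNum (Fintype.card F) (n - (2 * x.start + j))) • theta n (x.vec (x.start + j)) := by
  rw [Chain.upper]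
  simp only
  split_ifs with h
  · rw [show x.start + j + 1 + x.start - 1 = 2 * x.start + j by omega, Nat.add_sub_cancel,
      show n + 1 - (x.start + j + 1 + x.start) = n - (2 * x.start + j) by omega]
  · rw [hx.eq_zero (x.start + j + 1) (by omega), show n - (2 * x.start + j) = 0 by omega]
    simp

theorem stdInner_step {u : ℕ} {y : V F n} (hy : y ∈ graded F n u) (hu : u ≤ n) (v v' y' : V F n)
    (a b a' b' : ℂ) :
    stdInner (a • vIncl n v + b • theta n y) (a' • vIncl n v' + b' • theta n y') =
      starRingEnd ℂ a * a' * stdInner v v' +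
        starRingEnd ℂ b * b' * (Fintype.card F : ℂ) ^ (n - u) * stdInner y y' := by
  simp only [stdInner_add_left, stdInner_add_right, stdInner_smul_left, stdInner_smul_right,
    stdInner_vIncl, stdInner_theta hy hu, stdInner_vIncl_theta,
    stdInner_eq_zero_symm (stdInner_vIncl_theta _ _)]
  ring

theorem IsJordan.norm_lower (hx : IsJordan x) {j i : ℕ} (h : 2 * x.start + j + i = n) :
    stdInner (x.lower.vec (x.start + j + 1)) (x.lower.vec (x.start + j + 1)) =
      (Fintype.card F : ℂ) ^ x.start * qNum (Fintype.card F) (j + 1) *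
        qNum (Fintype.card F) (i + (j + 1)) *
        stdInner (x.vec (x.start + j)) (x.vec (x.start + j)) := by
  rw [hx.lower_vec, ← one_smul ℂ (vIncl n _),
    stdInner_step (hx.mem_graded _) (by omega : x.start + j ≤ n), hx.norm_vec j i h,
    show n - (x.start + j) = x.start + i by omega, qNum_add _ i (j + 1), conj_qNum, map_one]
  ring

theorem IsJordan.norm_upper (hx : IsJordan x) {j i : ℕ} (h : 2 * x.start + j + i = n) :
    stdInner (x.upper.vec (x.start + j + 1)) (x.upper.vec (x.start + j + 1)) =
      (Fintype.card F : ℂ) ^ (5 * x.start + 2 * j + i) * qNum (Fintype.card F) i *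
        qNum (Fintype.card F) (i + (j + 1)) *
        stdInner (x.vec (x.start + j)) (x.vec (x.start + j)) := by
  have hn : (Fintype.card F : ℂ) ^ n = (Fintype.card F : ℂ) ^ (2 * x.start + j + i) := by rw [h]
  rw [hx.upper_vec, stdInner_step (hx.mem_graded _) (by omega : x.start + j ≤ n),
    hx.norm_vec j i h, show n - (x.start + j) = x.start + i by omega,
    show n - (2 * x.start + j) = i by omega, qNum_add _ i (j + 1), hn]
  simp only [map_neg, map_pow, map_mul, map_natCast, conj_qNum]
  ring

/-- The two chains obtained from a chain are orthogonal; this is where the lengths of the vectors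
matter. -/
theorem IsJordan.stdInner_lower_upper (hx : IsJordan x) (u : ℕ) :
    stdInner (x.lower.vec u) (x.upper.vec u) = 0 := by
  by_cases hu : x.start + 1 ≤ u ∧ u + x.start ≤ n
  · obtain ⟨j, rfl⟩ : ∃ j, u = x.start + j + 1 := ⟨u - x.start - 1, by omega⟩
    obtain ⟨i, hi⟩ : ∃ i, 2 * x.start + j + i = n := ⟨n - (2 * x.start + j), by omega⟩
    have hn : (Fintype.card F : ℂ) ^ n = (Fintype.card F : ℂ) ^ (2 * x.start + j + i) := by rw [hi]
    rw [hx.upper_vec, hx.lower_vec, ← one_smul ℂ (vIncl n (x.vec _)), smul_smul,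
      stdInner_step (hx.mem_graded _) (by omega : x.start + j ≤ n),
      hx.norm_vec j i hi, show n - (x.start + j) = x.start + i by omega,
      show n - (2 * x.start + j) = i by omega, hn, conj_qNum, map_one]
    ring
  · rw [show x.upper.vec u = 0 from if_neg hu, stdInner_zero_right]

theorem IsJordan.lower (hx : IsJordan x) : IsJordan x.lower where
  start_le := hx.start_le.trans (Nat.le_succ n)
  mem_graded u := by
    rw [Chain.lower]
    simp only
    split_ifs with h
    · refine Submodule.add_mem _ (vIncl_mem_graded (hx.mem_graded u)) ?_
      cases u with
      | zero => simp
      | succ u => exact Submodule.smul_mem _ _ (theta_mem_graded (hx.mem_graded u))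
    · exact Submodule.zero_mem _
  eq_zero u hu := if_neg hu
  start_ne_zero := by
    change x.lower.vec x.start ≠ 0
    rw [Ne, ← stdInner_self_eq_zero, hx.lower_vec_start, stdInner_vIncl, stdInner_self_eq_zero]
    exact hx.start_ne_zero
  up_vec j := by
    change up F (n + 1) (x.lower.vec (x.start + j)) = x.lower.vec (x.start + j + 1)
    rw [hx.lower_vec]
    cases j with
    | zero =>
      rw [add_zero, hx.lower_vec_start, up_vIncl, qNum_one, one_smul]
      congr 2
      exact hx.up_vec 0
    | succ j =>
      rw [← add_assoc, hx.lower_vec, map_add, map_smul, up_vIncl, up_theta, hx.up_vec j,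
        qNum_succ' _ (j + 1), add_assoc x.start j 1, hx.up_vec (j + 1), add_smul, one_smul,
        mul_comm, mul_smul]
      abel
  norm_vec j i h := by
    change 2 * x.start + j + i = n + 1 at h
    change stdInner (x.lower.vec (x.start + j + 1)) (x.lower.vec (x.start + j + 1)) =
      _ ^ x.start * _ * _ * stdInner (x.lower.vec (x.start + j)) (x.lower.vec (x.start + j))
    cases i with
    | zero =>
      rw [show x.lower.vec (x.start + j + 1) = 0 from if_neg (by omega)]
      simp
    | succ i =>
      rw [hx.norm_lower (by omega : 2 * x.start + j + i = n)]
      cases j with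
      | zero =>
        rw [add_zero, hx.lower_vec_start, stdInner_vIncl]
      | succ j =>
        rw [← add_assoc x.start, hx.norm_lower (by omega : 2 * x.start + j + (i + 1) = n),
          hx.norm_vec j (i + 1) (by omega), show i + (j + 1 + 1) = i + 1 + (j + 1) by omega]
        ring

theorem IsJordan.upper (hx : IsJordan x) (h : 2 * x.start < n) : IsJordan x.upper where
  start_le := by
    change 2 * (x.start + 1) ≤ n + 1
    omega
  mem_graded u := by
    rw [Chain.upper]
    simp only
    split_ifs with h
    · refine Submodule.add_mem _ (Submodule.smul_mem _ _ (vIncl_mem_graded (hx.mem_graded u))) ?_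
      cases u with
      | zero => omega
      | succ u => exact Submodule.smul_mem _ _ (theta_mem_graded (hx.mem_graded u))
    · exact Submodule.zero_mem _
  eq_zero u hu := by
    refine if_neg fun h' => hu ?_
    change x.start + 1 ≤ u ∧ u + (x.start + 1) ≤ n + 1
    omega
  start_ne_zero := by
    have hq : (Fintype.card F : ℂ) ≠ 0 := Nat.cast_ne_zero.2 Fintype.card_ne_zero
    obtain ⟨i, hi⟩ := Nat.exists_eq_add_of_lt h
    change x.upper.vec (x.start + 0 + 1) ≠ 0
    rw [Ne, ← stdInner_self_eq_zero, hx.norm_upper (by omega : 2 * x.start + 0 + (i + 1) = n)]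
    refine mul_ne_zero (mul_ne_zero (mul_ne_zero (pow_ne_zero _ hq) (qNum_succ_ne_zero _ _))
      (qNum_succ_ne_zero _ _)) ?_
    rw [Ne, stdInner_self_eq_zero]
    exact hx.start_ne_zero
  up_vec j := by
    change up F (n + 1) (x.upper.vec (x.start + 1 + j)) = x.upper.vec (x.start + 1 + j + 1)
    rw [add_right_comm, add_assoc x.start j 1, hx.upper_vec (j + 1), ← add_assoc, hx.upper_vec,
      map_add, map_smul, map_smul, up_vIncl, up_theta, hx.up_vec, add_assoc x.start j 1,
      hx.up_vec (j + 1)]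
    by_cases hj : 2 * x.start + j + 1 ≤ n
    · obtain ⟨i, hi⟩ := Nat.exists_eq_add_of_le hj
      have hn : (Fintype.card F : ℂ) ^ n = (Fintype.card F : ℂ) ^ (2 * x.start + j + 1 + i) := by
        rw [← hi]
      rw [show n - (2 * x.start + j) = i + 1 by omega,
        show n - (2 * x.start + (j + 1)) = i by omega, qNum_succ, hn]
      module
    · rw [hx.eq_zero (x.start + (j + 1)) (by omega)]
      simp
  norm_vec j i h := by
    change 2 * (x.start + 1) + j + i = n + 1 at h
    change stdInner (x.upper.vec (x.start + 1 + j + 1)) (x.upper.vec (x.start + 1 + j + 1)) =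
      _ ^ (x.start + 1) * _ * _ *
        stdInner (x.upper.vec (x.start + 1 + j)) (x.upper.vec (x.start + 1 + j))
    rw [add_right_comm x.start 1 j, add_assoc x.start j 1,
      hx.norm_upper (by omega : 2 * x.start + (j + 1) + i = n), ← add_assoc x.start j 1,
      hx.norm_upper (by omega : 2 * x.start + j + (i + 1) = n),
      hx.norm_vec j (i + 1) (by omega), show i + (j + 1 + 1) = i + 1 + (j + 1) by omega]
    ring

theorem IsJordan.shift (hx : IsJordan x) {χ : AddChar (Fin (n + 1) → F) ℂ} (hχ : χ ≠ 1)
    {M : Matrix (Fin (n + 1)) (Fin n) F} (hM : IsSchubert M)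
    (hχM : ∀ y ∈ LinearMap.range M.mulVecLin, χ y = 1) : IsJordan (x.shift χ M) where
  start_le := by
    have := hx.start_le
    change 2 * (x.start + 1) ≤ n + 2
    omega
  mem_graded u := by
    cases u with
    | zero => exact Submodule.zero_mem _
    | succ u => exact gamma_mem_graded χ hM.injective (hx.mem_graded u)
  eq_zero u hu := by
    change ¬ (x.start + 1 ≤ u ∧ u + (x.start + 1) ≤ n + 2) at hu
    cases u with
    | zero => rfl
    | succ u =>
      change gamma χ M (x.vec u) = 0
      rw [hx.eq_zero u (by omega), map_zero]
  start_ne_zero := by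
    have hq : (Fintype.card F : ℂ) ≠ 0 := Nat.cast_ne_zero.2 Fintype.card_ne_zero
    change gamma χ M (x.vec x.start) ≠ 0
    rw [Ne, ← stdInner_self_eq_zero, stdInner_gamma hM.injective hχM (hx.mem_graded _)]
    refine mul_ne_zero (pow_ne_zero _ hq) ?_
    rw [Ne, stdInner_self_eq_zero]
    exact hx.start_ne_zero
  up_vec j := by
    change up F (n + 2) ((x.shift χ M).vec (x.start + 1 + j)) =
      (x.shift χ M).vec (x.start + 1 + j + 1)
    rw [add_right_comm]
    change up F (n + 2) (gamma χ M (x.vec (x.start + j))) = gamma χ M (x.vec (x.start + j + 1))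
    rw [up_gamma hM.injective hχ hχM, hx.up_vec]
  norm_vec j i h := by
    change 2 * (x.start + 1) + j + i = n + 2 at h
    change stdInner ((x.shift χ M).vec (x.start + 1 + j + 1))
        ((x.shift χ M).vec (x.start + 1 + j + 1)) =
      _ ^ (x.start + 1) * _ * _ * stdInner ((x.shift χ M).vec (x.start + 1 + j))
        ((x.shift χ M).vec (x.start + 1 + j))
    rw [add_right_comm x.start 1 j]
    change stdInner (gamma χ M (x.vec (x.start + j + 1))) (gamma χ M (x.vec (x.start + j + 1))) =
      _ * stdInner (gamma χ M (x.vec (x.start + j))) (gamma χ M (x.vec (x.start + j)))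
    rw [stdInner_gamma hM.injective hχM (hx.mem_graded _),
      stdInner_gamma hM.injective hχM (hx.mem_graded _), hx.norm_vec j i (by omega)]
    ring

end Step

/-! ### The chains of `J_q(n)` -/

theorem up_single_top (n : ℕ) : up F n (Finsupp.single ⊤ 1) = 0 := by
  classical
  rw [up_single]
  refine Finset.sum_eq_zero fun Y hY => ?_
  have h1 := (Finset.mem_filter.1 hY).2.2
  have h2 := Submodule.finrank_le Y
  rw [finrank_top] at h1
  omega

theorem up_single_bot_of_one : up F 1 (Finsupp.single ⊥ 1) = Finsupp.single ⊤ 1 := by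
  classical
  rw [up_single, Finset.sum_eq_single_of_mem ⊤]
  · simp [Covers]
  · intro Y hY hne
    refine absurd (Submodule.eq_top_of_finrank_eq ?_) hne
    have := (Finset.mem_filter.1 hY).2.2
    rw [finrank_bot] at this
    rw [this, finrank_fin_fun]

theorem isJordan_of_mem_chains {n : ℕ} : ∀ {c : Chain F n}, c ∈ chains F n → IsJordan c := by
  induction n using Nat.twoStepInduction with
  | zero =>
    rintro c rfl
    have hz : (⊥ : Bq F 0) = ⊤ := Subsingleton.elim _ _
    refine ⟨le_rfl, fun u => ?_, fun u hu => if_neg (by simpa using hu), ?_, fun j => ?_,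
      fun j i h => ?_⟩
    · simp only
      split_ifs with h
      · exact single_mem_graded (by simp [h]) _
      · exact Submodule.zero_mem _
    · simp
    · cases j with
      | zero => simpa [hz] using up_single_top (F := F) 0
      | succ j => simp
    · obtain rfl : i = 0 := by omega
      simp
  | one =>
    rintro c rfl
    refine ⟨by simp, fun u => ?_, fun u hu => ?_, by simp, fun j => ?_, fun j i h => ?_⟩
    · simp only
      split_ifs with h h
      · exact single_mem_graded (by simp [h]) _
      · exact single_mem_graded (by simp [h]) _
      · exact Submodule.zero_mem _
    · simp only at hu ⊢
      rw [if_neg (by omega), if_neg (by omega)]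
    · rcases j with _ | _ | j
      · simpa using up_single_bot_of_one
      · simpa using up_single_top (F := F) 1
      · simp
    · simp only at h
      obtain ⟨rfl, rfl⟩ | ⟨rfl, rfl⟩ : (j = 0 ∧ i = 1) ∨ (j = 1 ∧ i = 0) := by omega
      · simp [qNum_one, stdInner_single_left]
      · simp
  | more n ih0 ih1 =>
    rintro c ((⟨x, hx, rfl⟩ | ⟨x, hx, h, rfl⟩) | ⟨χ, hχ, M, hM, hχM, x, hx, rfl⟩)
    · exact (ih1 hx).lower
    · exact (ih1 hx).upper h
    · exact (ih0 hx).shift hχ hM (charSum_hat_ne_zero_iff.1 hχM)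

theorem exists_lower_vec_eq {n : ℕ} (x : Chain F n) (u : ℕ) : ∃ a b : ℂ,
    x.lower.vec u = a • vIncl n (x.vec u) + b • theta n (x.vec (u - 1)) := by
  rw [Chain.lower]
  simp only
  split_ifs
  · exact ⟨1, _, by rw [one_smul]⟩
  · exact ⟨0, 0, by simp⟩

theorem exists_upper_vec_eq {n : ℕ} (x : Chain F n) (u : ℕ) : ∃ a b : ℂ,
    x.upper.vec u = a • vIncl n (x.vec u) + b • theta n (x.vec (u - 1)) := by
  rw [Chain.upper]
  simp only
  split_ifs
  · exact ⟨_, _, rfl⟩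
  · exact ⟨0, 0, by simp⟩

theorem stdInner_step_eq_zero {n : ℕ} {x x' : Chain F n} (hx : IsJordan x)
    (h : ∀ u, stdInner (x.vec u) (x'.vec u) = 0) (u : ℕ) (a b a' b' : ℂ) :
    stdInner (a • vIncl n (x.vec u) + b • theta n (x.vec (u - 1)))
      (a' • vIncl n (x'.vec u) + b' • theta n (x'.vec (u - 1))) = 0 := by
  by_cases hu : u - 1 ≤ n
  · rw [stdInner_step (hx.mem_graded (u - 1)) hu, h, h]
    ring
  · rw [hx.eq_zero u (by omega), hx.eq_zero (u - 1) (by omega)]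
    simp

theorem stdInner_step_shift {n : ℕ} {χ : AddChar (Fin (n + 1) → F) ℂ} (hχ : χ ≠ 1)
    (M : Matrix (Fin (n + 1)) (Fin n) F) (v w : V F (n + 1)) (a b : ℂ) (x : Chain F n) (u : ℕ) :
    stdInner (a • vIncl (n + 1) v + b • theta (n + 1) w) ((x.shift χ M).vec u) = 0 := by
  cases u with
  | zero => exact stdInner_zero_right _
  | succ u =>
    change stdInner _ (gamma χ M (x.vec u)) = 0
    simp [stdInner_add_left, stdInner_smul_left, stdInner_vIncl_gamma, stdInner_theta_gamma hχ]

/-- Different chains of `J_q(n)` are orthogonal. -/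
theorem stdInner_of_mem_chains {n : ℕ} : ∀ {c c' : Chain F n}, c ∈ chains F n → c' ∈ chains F n →
    c ≠ c' → ∀ u, stdInner (c.vec u) (c'.vec u) = 0 := by
  induction n using Nat.twoStepInduction with
  | zero =>
    rintro c c' rfl rfl h
    exact absurd rfl h
  | one =>
    rintro c c' rfl rfl h
    exact absurd rfl h
  | more n ih0 ih1 =>
    -- the part of `V(B_q(n + 2))` spanned by `V(B_q(n + 1))` and the vectors `θ(X)`
    have step : ∀ {x x' : Chain F (n + 1)}, x ∈ chains F (n + 1) → x' ∈ chains F (n + 1) →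
        x ≠ x' → ∀ (u : ℕ) (v v' : V F (n + 2)),
        (∃ a b : ℂ, v = a • vIncl _ (x.vec u) + b • theta _ (x.vec (u - 1))) →
        (∃ a b : ℂ, v' = a • vIncl _ (x'.vec u) + b • theta _ (x'.vec (u - 1))) →
        stdInner v v' = 0 := by
      rintro x x' hx hx' hne u _ _ ⟨a, b, rfl⟩ ⟨a', b', rfl⟩
      exact stdInner_step_eq_zero (isJordan_of_mem_chains hx) (ih1 hx hx' hne) u a b a' b'
    have low_up : ∀ {x x' : Chain F (n + 1)}, x ∈ chains F (n + 1) → x' ∈ chains F (n + 1) →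
        ∀ u, stdInner (x.lower.vec u) (x'.upper.vec u) = 0 := by
      intro x x' hx hx' u
      by_cases hxx : x = x'
      · subst hxx
        exact (isJordan_of_mem_chains hx).stdInner_lower_upper u
      · exact step hx hx' hxx u _ _ (exists_lower_vec_eq x u) (exists_upper_vec_eq x' u)
    have step_shift : ∀ {χ : AddChar (Fin (n + 1) → F) ℂ}, χ ≠ 1 → ∀ M (x : Chain F n)
        (x' : Chain F (n + 1)) u (v : V F (n + 2)),
        (∃ a b : ℂ, v = a • vIncl _ (x'.vec u) + b • theta _ (x'.vec (u - 1))) →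
        stdInner v ((x.shift χ M).vec u) = 0 := by
      rintro χ hχ M x x' u _ ⟨a, b, rfl⟩
      exact stdInner_step_shift hχ M _ _ a b x u
    rintro c c' ((⟨x, hx, rfl⟩ | ⟨x, hx, h, rfl⟩) | ⟨χ, hχ, M, hM, hχM, x, hx, rfl⟩)
      ((⟨x', hx', rfl⟩ | ⟨x', hx', h', rfl⟩) | ⟨χ', hχ', M', hM', hχM', x', hx', rfl⟩) hne u
    · exact step hx hx' (fun h => hne (h ▸ rfl)) u _ _ (exists_lower_vec_eq x u)
        (exists_lower_vec_eq x' u)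
    · exact low_up hx hx' u
    · exact step_shift hχ' M' x' x u _ (exists_lower_vec_eq x u)
    · exact stdInner_eq_zero_symm (low_up hx' hx u)
    · exact step hx hx' (fun h => hne (h ▸ rfl)) u _ _ (exists_upper_vec_eq x u)
        (exists_upper_vec_eq x' u)
    · exact step_shift hχ' M' x' x u _ (exists_upper_vec_eq x u)
    · exact stdInner_eq_zero_symm (step_shift hχ M x x' u _ (exists_lower_vec_eq x' u))
    · exact stdInner_eq_zero_symm (step_shift hχ M x x' u _ (exists_upper_vec_eq x' u))
    · cases u with
      | zero => exact stdInner_zero_right _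
      | succ u =>
        change stdInner (gamma χ M (x.vec u)) (gamma χ' M' (x'.vec u)) = 0
        by_cases hχχ : χ = χ'
        · subst hχχ
          obtain rfl : M = M' := eq_of_isSchubert_of_char hχ hM hM'
            (charSum_hat_ne_zero_iff.1 hχM) (charSum_hat_ne_zero_iff.1 hχM')
          have hxx : x ≠ x' := fun h => hne (h ▸ rfl)
          rw [stdInner_gamma hM.injective (charSum_hat_ne_zero_iff.1 hχM)
            ((isJordan_of_mem_chains hx).mem_graded u), ih0 hx hx' hxx, mul_zero]
        · exact stdInner_gamma_gamma_of_ne hχχ M M' _ _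

/-! ### The vectors of `J_q(n)` span -/

theorem vec_mem_span_Jq {n : ℕ} {c : Chain F n} (hc : c ∈ chains F n) (u : ℕ) :
    c.vec u ∈ Submodule.span ℂ (Jq F n) := by
  by_cases hu : c.start ≤ u ∧ u + c.start ≤ n
  · exact Submodule.subset_span ⟨c, hc, u, hu.1, hu.2, rfl⟩
  · rw [(isJordan_of_mem_chains hc).eq_zero u hu]
    exact Submodule.zero_mem _

/-- Fourier inversion: the orbit of `X̂` under shears lies in the span of the vectors `p(χ)(X̂)`. -/
theorem sum_char_smul_charSum {n : ℕ} (X : Bq F n) (b : Fin n → F) :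
    ∑ χ : AddChar (Fin n → F) ℂ, χ b • charSum χ (hat X) =
      (Fintype.card F : ℂ) ^ n • Finsupp.single ((hat X).map (shear b)) 1 := by
  classical
  have h : ∀ χ : AddChar (Fin n → F) ℂ, χ b • charSum χ (hat X) =
      ∑ a, Finsupp.single ((hat X).map (shear a)) (χ (b - a)) := by
    intro χ
    rw [charSum, Finset.smul_sum]
    refine Finset.sum_congr rfl fun a _ => ?_
    rw [Finsupp.smul_single, smul_eq_mul, sub_eq_add_neg, AddChar.map_add_eq_mul,
      AddChar.map_neg_eq_conj]
  rw [Finset.sum_congr rfl fun χ _ => h χ, Finset.sum_comm, Finset.sum_eq_single b]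
  · rw [← Finsupp.single_finsetSum, AddChar.sum_apply_eq_ite, sub_self, if_pos rfl]
    simp
  · intro a _ ha
    rw [← Finsupp.single_finsetSum, AddChar.sum_apply_eq_ite, if_neg (sub_ne_zero.2 ha.symm)]
    simp
  · simp

/-- `V(B_q(n + 1))` is spanned by `V(B_q(n))` and the vectors `p(χ)(X̂)`. -/
theorem eq_top_of_vIncl_of_charSum {n : ℕ} (S : Submodule ℂ (V F (n + 1)))
    (h1 : ∀ X : Bq F n, vIncl n (Finsupp.single X 1) ∈ S)
    (h2 : ∀ (χ : AddChar (Fin n → F) ℂ) (X : Bq F n), charSum χ (hat X) ∈ S) : S = ⊤ := by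
  have hq : (Fintype.card F : ℂ) ≠ 0 := Nat.cast_ne_zero.2 Fintype.card_ne_zero
  have hs : ∀ Y : Bq F (n + 1), Finsupp.single Y (1 : ℂ) ∈ S := by
    intro Y
    by_cases hY : Y ≤ LinearMap.range (incl F n)
    · have := h1 (Y.comap (incl F n))
      rwa [vIncl_single, Submodule.map_comap_eq, inf_eq_right.2 hY] at this
    · obtain ⟨a, ha⟩ := exists_map_shear_hat_eq hY
      have h := sum_char_smul_charSum (Y.comap (incl F n)) a
      rw [ha] at h
      rw [← S.smul_mem_iff (pow_ne_zero n hq), ← h]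
      exact S.sum_mem fun χ _ => S.smul_mem _ (h2 χ _)
  rw [eq_top_iff]
  intro v _
  rw [eq_sum_single v]
  exact S.sum_mem fun Y _ => S.smul_mem _ (hs Y)

theorem vIncl_and_theta_vec_mem_span {n : ℕ} {x : Chain F (n + 1)} (hx : x ∈ chains F (n + 1))
    (u : ℕ) : vIncl (n + 1) (x.vec u) ∈ Submodule.span ℂ (Jq F (n + 2)) ∧
      theta (n + 1) (x.vec u) ∈ Submodule.span ℂ (Jq F (n + 2)) := by
  set S := Submodule.span ℂ (Jq F (n + 2)) with hS
  have hq : (Fintype.card F : ℂ) ≠ 0 := Nat.cast_ne_zero.2 Fintype.card_ne_zero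
  have hJ := isJordan_of_mem_chains hx
  have hlow : ∀ u, x.lower.vec u ∈ S := vec_mem_span_Jq (Or.inl (Or.inl ⟨x, hx, rfl⟩))
  have hstart : vIncl (n + 1) (x.vec x.start) ∈ S := hJ.lower_vec_start ▸ hlow x.start
  have key : ∀ j, theta (n + 1) (x.vec (x.start + j)) ∈ S ∧
      vIncl (n + 1) (x.vec (x.start + j + 1)) ∈ S := by
    intro j
    have h1 := hlow (x.start + j + 1)
    rw [hJ.lower_vec] at h1
    suffices h : theta (n + 1) (x.vec (x.start + j)) ∈ S from
      ⟨h, (S.add_mem_iff_left (S.smul_mem _ h)).1 h1⟩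
    by_cases hj : 2 * x.start + j < n + 1
    · -- `q ^ (n + 1) y + z` is a nonzero multiple of `θ(x)`
      have h2 : x.upper.vec (x.start + j + 1) ∈ S :=
        vec_mem_span_Jq (Or.inl (Or.inr ⟨x, hx, by omega, rfl⟩)) _
      rw [hJ.upper_vec] at h2
      obtain ⟨i, hi⟩ : ∃ i, 2 * x.start + j + i = n + 1 := ⟨n + 1 - (2 * x.start + j), by omega⟩
      have hn : (Fintype.card F : ℂ) ^ (n + 1) =
          (Fintype.card F : ℂ) ^ (2 * x.start + j) * (Fintype.card F : ℂ) ^ i := by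
        rw [← pow_add, hi]
      have h3 := S.add_mem (S.smul_mem ((Fintype.card F : ℂ) ^ (n + 1)) h1) h2
      have h4 : (Fintype.card F : ℂ) ^ (n + 1) •
          (vIncl (n + 1) (x.vec (x.start + j + 1)) +
            qNum (Fintype.card F) (j + 1) • theta (n + 1) (x.vec (x.start + j))) +
          ((-(Fintype.card F : ℂ) ^ (n + 1)) • vIncl (n + 1) (x.vec (x.start + j + 1)) +
          ((Fintype.card F : ℂ) ^ (2 * x.start + j) *
          qNum (Fintype.card F) (n + 1 - (2 * x.start + j))) •
            theta (n + 1) (x.vec (x.start + j))) =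
          ((Fintype.card F : ℂ) ^ (2 * x.start + j) * qNum (Fintype.card F) (i + j + 1)) •
            theta (n + 1) (x.vec (x.start + j)) := by
        rw [show n + 1 - (2 * x.start + j) = i by omega, add_assoc i, qNum_add _ i (j + 1), hn]
        module
      rw [h4] at h3
      exact (S.smul_mem_iff (mul_ne_zero (pow_ne_zero _ hq) (qNum_succ_ne_zero _ _))).1 h3
    · rw [hJ.eq_zero (x.start + j + 1) (by omega), map_zero, zero_add] at h1
      exact (S.smul_mem_iff (qNum_succ_ne_zero _ _)).1 h1
  by_cases hu : x.start ≤ u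
  · obtain ⟨j, rfl⟩ := Nat.exists_eq_add_of_le hu
    refine ⟨?_, (key j).1⟩
    cases j with
    | zero => exact hstart
    | succ j => exact (key j).2
  · rw [hJ.eq_zero u (by omega)]
    simp

theorem span_Jq (n : ℕ) : Submodule.span ℂ (Jq F n) = ⊤ := by
  induction n using Nat.twoStepInduction with
  | zero =>
    rw [eq_top_iff]
    intro v _
    rw [eq_sum_single v]
    refine Submodule.sum_mem _ fun X _ => Submodule.smul_mem _ _ ?_
    rw [Subsingleton.elim X ⊥]
    exact Submodule.subset_span ⟨_, rfl, 0, le_rfl, le_rfl, by simp⟩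
  | one =>
    rw [eq_top_iff]
    intro v _
    rw [eq_sum_single v]
    refine Submodule.sum_mem _ fun X _ => Submodule.smul_mem _ _ ?_
    have hX := Submodule.finrank_le X
    rw [finrank_fin_fun] at hX
    obtain h | h : finrank F X = 0 ∨ finrank F X = 1 := by omega
    · rw [Submodule.finrank_eq_zero.1 h]
      exact Submodule.subset_span ⟨_, rfl, 0, le_rfl, Nat.zero_le _, by simp⟩
    · rw [Submodule.eq_top_of_finrank_eq (h.trans (finrank_fin_fun F).symm)]
      exact Submodule.subset_span ⟨_, rfl, 1, Nat.zero_le _, le_rfl, by simp⟩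
  | more n ih0 ih1 =>
    have lift : ∀ {m : ℕ} (f : V F m →ₗ[ℂ] V F (n + 2)), Submodule.span ℂ (Jq F m) = ⊤ →
        (∀ c ∈ chains F m, ∀ u, f (c.vec u) ∈ Submodule.span ℂ (Jq F (n + 2))) →
        ∀ v, f v ∈ Submodule.span ℂ (Jq F (n + 2)) := by
      intro m f hm hf v
      have : Submodule.span ℂ (Jq F m) ≤ (Submodule.span ℂ (Jq F (n + 2))).comap f := by
        rw [Submodule.span_le]
        rintro _ ⟨c, hc, u, -, -, rfl⟩
        exact hf c hc u
      exact this (hm ▸ Submodule.mem_top)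
    have htheta := lift (theta (n + 1)) ih1 fun c hc u => (vIncl_and_theta_vec_mem_span hc u).2
    refine eq_top_of_vIncl_of_charSum _ (fun X => lift (vIncl (n + 1)) ih1
      (fun c hc u => (vIncl_and_theta_vec_mem_span hc u).1) _) fun χ X => ?_
    by_cases hχ : χ = 1
    · subst hχ
      rw [charSum_one_hat]
      exact Submodule.smul_mem _ _ (htheta _)
    · obtain ⟨M, hM, hχM⟩ := exists_isSchubert_of_ne_one hχ
      by_cases h0 : charSum χ (hat X) = 0
      · rw [h0]
        exact Submodule.zero_mem _
      · -- `X` is contained in the hyperplane of `χ`, so `p(χ)(X̂)` is in the range of `γ(χ)`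
        have hle := le_of_char_eq_one hχ (finrank_range_mulVecLin hM.injective) hχM
          (charSum_hat_ne_zero_iff.1 h0)
        have hX : (X.comap M.mulVecLin).map M.mulVecLin = X := by
          rw [Submodule.map_comap_eq, inf_eq_right.2 hle]
        rw [← hX, ← gamma_single]
        refine lift (gamma χ M) ih0 (fun c hc u => ?_) _
        exact vec_mem_span_Jq (c := c.shift χ M)
          (Or.inr ⟨χ, hχ, M, hM, charSum_hat_ne_zero_iff.2 hχM, c, hc, rfl⟩) (u + 1)

/-! ### Pairs of subspaces up to linear equivalence -/

theorem exists_relCompl {E : Type*} [AddCommGroup E] [Module F E] {I X : Submodule F E}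
    (h : I ≤ X) : ∃ A : Submodule F E, I ⊔ A = X ∧ I ⊓ A = ⊥ := by
  obtain ⟨C, hC⟩ := exists_isCompl I
  refine ⟨C ⊓ X, ?_, ?_⟩
  · rw [← sup_inf_assoc_of_le C h, hC.sup_eq_top, top_inf_eq]
  · rw [← inf_assoc, hC.inf_eq_bot, bot_inf_eq]

/-- A pair of subspaces `X`, `Y` in coordinates adapted to `X ∩ Y`, to complements of `X ∩ Y` in `X`
and in `Y`, and to a complement of `X + Y`. -/
theorem exists_equiv_of_pair {E : Type*} [AddCommGroup E] [Module F E] [FiniteDimensional F E]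
    {X Y : Submodule F E} {i a b c : ℕ} (hi : finrank F ↥(X ⊓ Y) = i) (ha : finrank F X = i + a)
    (hb : finrank F Y = i + b) (hc : finrank F E = i + a + b + c) :
    ∃ e : ((Fin i → F) × (Fin a → F) × (Fin b → F) × (Fin c → F)) ≃ₗ[F] E,
      (Submodule.prod ⊤ (Submodule.prod ⊤ (Submodule.prod ⊥ ⊥))).map e.toLinearMap = X ∧
      (Submodule.prod ⊤ (Submodule.prod ⊥ (Submodule.prod ⊤ ⊥))).map e.toLinearMap = Y := by
  obtain ⟨A, hA1, hA2⟩ := exists_relCompl (inf_le_left : X ⊓ Y ≤ X)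
  obtain ⟨B, hB1, hB2⟩ := exists_relCompl (inf_le_right : X ⊓ Y ≤ Y)
  obtain ⟨C, hC1, hC2⟩ := exists_relCompl (le_top : X ⊔ Y ≤ ⊤)
  have dA := Submodule.finrank_sup_add_finrank_inf_eq (X ⊓ Y) A
  have dB := Submodule.finrank_sup_add_finrank_inf_eq (X ⊓ Y) B
  have dC := Submodule.finrank_sup_add_finrank_inf_eq (X ⊔ Y) C
  have dXY := Submodule.finrank_sup_add_finrank_inf_eq X Y
  rw [hA1, hA2, finrank_bot] at dA
  rw [hB1, hB2, finrank_bot] at dB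
  rw [hC1, hC2, finrank_bot, finrank_top] at dC
  have equiv : ∀ {k : ℕ} (Z : Submodule F E), finrank F Z = k →
      ∃ f : (Fin k → F) →ₗ[F] E, LinearMap.range f = Z := by
    intro k Z hZ
    refine ⟨Z.subtype ∘ₗ (LinearEquiv.ofFinrankEq (Fin k → F) Z (by simp [hZ])).toLinearMap, ?_⟩
    rw [LinearEquiv.range_comp, Submodule.range_subtype]
  obtain ⟨fI, hfI⟩ := equiv (X ⊓ Y) hi
  obtain ⟨fA, hfA⟩ := equiv (k := a) A (by omega)
  obtain ⟨fB, hfB⟩ := equiv (k := b) B (by omega)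
  obtain ⟨fC, hfC⟩ := equiv (k := c) C (by omega)
  let φ := fI.coprod (fA.coprod (fB.coprod fC))
  have hsurj : Function.Surjective φ := by
    rw [← LinearMap.range_eq_top]
    simp only [φ, LinearMap.range_coprod, hfI, hfA, hfB, hfC]
    calc X ⊓ Y ⊔ (A ⊔ (B ⊔ C)) = (X ⊓ Y ⊔ A) ⊔ (X ⊓ Y ⊔ B) ⊔ C := by
          rw [← sup_sup_distrib_left, sup_assoc, sup_assoc]
      _ = ⊤ := by rw [hA1, hB1, hC1]
  have hinj : Function.Injective φ :=
    (LinearMap.injective_iff_surjective_of_finrank_eq_finrank (by simp [hc, add_assoc])).2 hsurj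
  refine ⟨LinearEquiv.ofBijective φ ⟨hinj, hsurj⟩, ?_, ?_⟩
  · change Submodule.map φ _ = X
    simp only [φ, LinearMap.map_coprod_prod, Submodule.map_top, Submodule.map_bot, hfI, hfA,
      sup_bot_eq, hA1]
  · change Submodule.map φ _ = Y
    simp only [φ, LinearMap.map_coprod_prod, Submodule.map_top, Submodule.map_bot, hfI, hfB,
      sup_bot_eq, bot_sup_eq, hB1]

/-! ### The commutant of `GL(n, q)` -/

section Commutant

variable {n m : ℕ}

theorem coe_smul (g : GL (Fin n) F) (X : BqRank F n m) :
    (g • X).1 = X.1.map (g : Matrix (Fin n) (Fin n) F).mulVecLin := rfl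

theorem mulVecLin_injective (g : GL (Fin n) F) :
    Function.Injective (g : Matrix (Fin n) (Fin n) F).mulVecLin :=
  Matrix.mulVec_injective_of_isUnit g.isUnit

theorem finrank_smul_inf_smul (g : GL (Fin n) F) (X Y : BqRank F n m) :
    finrank F ↥((g • X).1 ⊓ (g • Y).1) = finrank F ↥(X.1 ⊓ Y.1) := by
  rw [coe_smul, coe_smul, ← Submodule.map_inf _ (mulVecLin_injective g)]
  exact finrank_map_mulVecLin (mulVecLin_injective g) _

/-- `GL(n, q)` is transitive on the pairs of `m`-subspaces with a given dimension of the
intersection. -/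
theorem exists_smul_eq_and {X Y X' Y' : BqRank F n m}
    (h : finrank F ↥(X.1 ⊓ Y.1) = finrank F ↥(X'.1 ⊓ Y'.1)) :
    ∃ g : GL (Fin n) F, g • X = X' ∧ g • Y = Y' := by
  have h1 : finrank F ↥(X.1 ⊓ Y.1) ≤ finrank F X.1 := Submodule.finrank_mono inf_le_left
  have h2 : finrank F ↥(X.1 ⊔ Y.1) ≤ n := (Submodule.finrank_le _).trans (finrank_fin_fun F).le
  have h3 := Submodule.finrank_sup_add_finrank_inf_eq X.1 Y.1
  have hX := X.2
  have hY := Y.2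
  obtain ⟨a, ha⟩ := Nat.exists_eq_add_of_le h1
  obtain ⟨c, hc⟩ := Nat.exists_eq_add_of_le h2
  have hn : finrank F (Fin n → F) = finrank F ↥(X.1 ⊓ Y.1) + a + a + c := by
    rw [finrank_fin_fun]
    omega
  obtain ⟨e, heX, heY⟩ := exists_equiv_of_pair rfl ha (by omega) hn
  obtain ⟨e', heX', heY'⟩ := exists_equiv_of_pair (X := X'.1) (Y := Y'.1) (a := a) (b := a)
    (c := c) h.symm (by rw [X'.2]; omega) (by rw [Y'.2]; omega) hn
  let g : GL (Fin n) F := Matrix.GeneralLinearGroup.toLin.symm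
    (LinearMap.GeneralLinearGroup.ofLinearEquiv (e.symm.trans e'))
  have hg : (g : Matrix (Fin n) (Fin n) F).mulVecLin = e'.toLinearMap ∘ₗ e.symm.toLinearMap := by
    rw [← Matrix.GeneralLinearGroup.coe_toLin, MulEquiv.apply_symm_apply]
    rfl
  have hcomp : ∀ P, (Submodule.map e.toLinearMap P).map (g : Matrix (Fin n) (Fin n) F).mulVecLin =
      Submodule.map e'.toLinearMap P := by
    intro P
    rw [hg, ← Submodule.map_comp, LinearMap.comp_assoc, LinearEquiv.symm_comp, LinearMap.comp_id]
  refine ⟨g, Subtype.ext ?_, Subtype.ext ?_⟩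
  · rw [coe_smul, ← heX, hcomp, heX']
  · rw [coe_smul, ← heY, hcomp, heY']

theorem glRep_single (g : GL (Fin n) F) (X : BqRank F n m) (a : ℂ) :
    glRep F n m g (Finsupp.single X a) = Finsupp.single (g • X) a :=
  Finsupp.mapDomain_single

theorem glRep_apply_smul (g : GL (Fin n) F) (v : VRank F n m) (Y : BqRank F n m) :
    glRep F n m g v (g • Y) = v Y :=
  Finsupp.mapDomain_apply (MulAction.injective g) v Y

/-- The commutant consists of the matrices that are constant on the orbits of `GL(n, q)` on pairs
of `m`-subspaces. -/
theorem mem_commutant_iff {T : Module.End ℂ (VRank F n m)} : T ∈ commutant F n m ↔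
    ∀ (g : GL (Fin n) F) (X Y : BqRank F n m),
      T (Finsupp.single (g • X) 1) (g • Y) = T (Finsupp.single X 1) Y := by
  rw [commutant, Subalgebra.mem_centralizer_iff]
  constructor
  · intro h g X Y
    have := LinearMap.congr_fun (h _ ⟨g, rfl⟩) (Finsupp.single X 1)
    rw [Module.End.mul_apply, Module.End.mul_apply, glRep_single] at this
    rw [← this, glRep_apply_smul]
  · rintro h _ ⟨g, rfl⟩
    refine Finsupp.lhom_ext' fun X => LinearMap.ext_ring (Finsupp.ext fun Y => ?_)
    obtain ⟨Y, rfl⟩ := MulAction.surjective g Y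
    change glRep F n m g (T (Finsupp.single X 1)) _ = T (glRep F n m g (Finsupp.single X 1)) _
    rw [glRep_single, glRep_apply_smul, h]

open Classical in
theorem assocMap_single_apply (i : ℕ) (X Y : BqRank F n m) :
    assocMap F n m i (Finsupp.single X 1) Y =
      if finrank F ↥(X.1 ⊓ Y.1) + i = m then 1 else 0 := by
  rw [assocMap, Finsupp.linearCombination_single, one_smul, sum_filter_single_apply]

theorem assocMap_mem_commutant (i : ℕ) : assocMap F n m i ∈ commutant F n m := by
  classical
  rw [mem_commutant_iff]
  intro g X Y
  rw [assocMap_single_apply, assocMap_single_apply, finrank_smul_inf_smul]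

theorem exists_entry_of_mem_commutant {T : Module.End ℂ (VRank F n m)}
    (hT : T ∈ commutant F n m) : ∃ t : ℕ → ℂ, ∀ X Y : BqRank F n m,
      T (Finsupp.single X 1) Y = t (finrank F ↥(X.1 ⊓ Y.1)) := by
  classical
  refine ⟨fun d => if h : ∃ P : BqRank F n m × BqRank F n m, finrank F ↥(P.1.1 ⊓ P.2.1) = d then
    T (Finsupp.single h.choose.1 1) h.choose.2 else 0, fun X Y => ?_⟩
  have h : ∃ P : BqRank F n m × BqRank F n m,
    finrank F ↥(P.1.1 ⊓ P.2.1) = finrank F ↥(X.1 ⊓ Y.1) := ⟨(X, Y), rfl⟩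
  beta_reduce
  rw [dif_pos h]
  obtain ⟨g, h1, h2⟩ := exists_smul_eq_and h.choose_spec.symm
  rw [← h1, ← h2, mem_commutant_iff.1 hT]

theorem eq_sum_assocMap {T : Module.End ℂ (VRank F n m)} {t : ℕ → ℂ}
    (ht : ∀ X Y : BqRank F n m, T (Finsupp.single X 1) Y = t (finrank F ↥(X.1 ⊓ Y.1))) :
    T = ∑ i ∈ Finset.range (m + 1), t (m - i) • assocMap F n m i := by
  classical
  refine Finsupp.lhom_ext' fun X => LinearMap.ext_ring (Finsupp.ext fun Y => ?_)
  simp only [LinearMap.comp_apply, Finsupp.lsingle_apply, LinearMap.sum_apply,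
    LinearMap.smul_apply, Finsupp.finsetSum_apply, Finsupp.smul_apply, assocMap_single_apply, ht]
  have hle : finrank F ↥(X.1 ⊓ Y.1) ≤ m := (Submodule.finrank_mono inf_le_left).trans X.2.le
  rw [Finset.sum_eq_single_of_mem (m - finrank F ↥(X.1 ⊓ Y.1))]
  · rw [if_pos (by omega), Nat.sub_sub_self hle, smul_eq_mul, mul_one]
  · rw [Finset.mem_range]
    omega
  · intro i _ hi
    rw [if_neg (by omega), smul_zero]

theorem toSubmodule_commutant (n m : ℕ) :
    Subalgebra.toSubmodule (commutant F n m) = boseMesner F n m := by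
  apply le_antisymm
  · intro T hT
    obtain ⟨t, ht⟩ := exists_entry_of_mem_commutant hT
    rw [eq_sum_assocMap ht]
    exact Submodule.sum_mem _ fun i hi => Submodule.smul_mem _ _ <| Submodule.subset_span
      ⟨i, Nat.lt_succ_iff.1 (Finset.mem_range.1 hi), rfl⟩
  · rw [boseMesner, Submodule.span_le]
    rintro _ ⟨i, -, rfl⟩
    exact assocMap_mem_commutant i

end Commutant

/-! ### Powers of the up and down operators -/

section Powers

variable {n : ℕ}

theorem exists_covers_le {Z X : Bq F n} (h : Z < X) : ∃ Z', Covers Z Z' ∧ Z' ≤ X := by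
  obtain ⟨x, hxX, hxZ⟩ := SetLike.exists_of_lt h
  refine ⟨Z ⊔ Submodule.span F {x}, ⟨le_sup_left, ?_⟩,
    sup_le h.le ((Submodule.span_singleton_le_iff_mem _ _).2 hxX)⟩
  have h1 := Submodule.finrank_sup_add_finrank_inf_eq Z (Submodule.span F {x})
  have hx0 : x ≠ 0 := fun h0 => hxZ (h0 ▸ Z.zero_mem)
  have h2 : Z ⊓ Submodule.span F {x} = ⊥ :=
    ((Submodule.disjoint_span_singleton' hx0).2 hxZ).eq_bot
  rw [h2, finrank_bot, finrank_span_singleton hx0] at h1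
  exact h1

/-- The coefficient of `Z` in `D ^ r X`, the number of flags from `Z` to `X`, is a natural number,
nonzero exactly when `Z` is a subspace of `X` of codimension `r`. -/
theorem exists_down_pow_single_apply (r : ℕ) (X Z : Bq F n) :
    ∃ c : ℕ, (down F n ^ r) (Finsupp.single X 1) Z = c ∧
      (c ≠ 0 ↔ Z ≤ X ∧ finrank F Z + r = finrank F X) := by
  classical
  induction r generalizing Z with
  | zero =>
    refine ⟨if X = Z then 1 else 0, by simp [Finsupp.single_apply], ?_⟩
    constructor
    · intro h
      obtain rfl : X = Z := by by_contra h'; exact h (if_neg h')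
      simp
    · rintro ⟨h1, h2⟩
      simp [Submodule.eq_of_le_of_finrank_eq h1 h2]
  | succ r ih =>
    choose c hc hc' using ih
    refine ⟨∑ Z' : Bq F n with Covers Z Z', c Z', ?_, ?_⟩
    · rw [pow_succ', Module.End.mul_apply, down_apply, Nat.cast_sum]
      exact Finset.sum_congr rfl fun Z' _ => hc Z'
    · rw [Ne, Finset.sum_eq_zero_iff]
      push Not
      constructor
      · rintro ⟨Z', hZ', h⟩
        obtain ⟨h1, h2⟩ := (Finset.mem_filter.1 hZ').2
        obtain ⟨h3, h4⟩ := (hc' Z').1 h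
        exact ⟨h1.trans h3, by omega⟩
      · rintro ⟨h1, h2⟩
        obtain ⟨Z', hZ', hX⟩ := exists_covers_le (lt_of_le_of_ne h1 (by rintro rfl; omega))
        refine ⟨Z', by simp [hZ'], (hc' Z').2 ⟨hX, ?_⟩⟩
        have := hZ'.2
        omega

theorem down_pow_single_map (r : ℕ) (e : (Fin n → F) ≃ₗ[F] (Fin n → F)) (X Z : Bq F n) :
    (down F n ^ r) (Finsupp.single (X.map e.toLinearMap) 1) (Z.map e.toLinearMap) =
      (down F n ^ r) (Finsupp.single X 1) Z := by
  classical
  induction r generalizing Z with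
  | zero =>
    simp [Finsupp.single_apply, (Submodule.map_injective_of_injective e.injective).eq_iff]
  | succ r ih =>
    rw [pow_succ', Module.End.mul_apply, Module.End.mul_apply, down_apply, down_apply,
      Finset.sum_filter, Finset.sum_filter]
    refine (Fintype.sum_equiv (Submodule.orderIsoMapComap e).toEquiv _ _ fun Z' => ?_).symm
    have hcov : Covers (Z.map e.toLinearMap) (Z'.map e.toLinearMap) ↔ Covers Z Z' := by
      rw [Covers, Covers, Submodule.map_le_map_iff_of_injective e.injective,
        LinearEquiv.finrank_map_eq, LinearEquiv.finrank_map_eq]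
    change (if Covers Z Z' then _ else _) =
      if Covers (Z.map e.toLinearMap) (Z'.map e.toLinearMap) then
        (down F n ^ r) (Finsupp.single (X.map e.toLinearMap) 1) (Z'.map e.toLinearMap) else 0
    simp only [hcov, ih]

theorem stdInner_up_pow_right (r : ℕ) (v w : V F n) :
    stdInner v ((up F n ^ r) w) = stdInner ((down F n ^ r) v) w := by
  induction r generalizing v with
  | zero => rfl
  | succ r ih =>
    rw [pow_succ', Module.End.mul_apply, stdInner_up_right, ih, pow_succ, Module.End.mul_apply]

theorem stdInner_vec_vec {c c' : Chain F n} (hc : c ∈ chains F n) (hc' : c' ∈ chains F n)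
    {u u' : ℕ} (h : c ≠ c' ∨ u ≠ u') : stdInner (c.vec u) (c'.vec u') = 0 := by
  by_cases hu : u = u'
  · subst hu
    exact stdInner_of_mem_chains hc hc' (h.resolve_right fun h => h rfl) u
  · exact stdInner_of_mem_graded hu ((isJordan_of_mem_chains hc).mem_graded u)
      ((isJordan_of_mem_chains hc').mem_graded u')

/-- The down operator maps each vector of a chain to a multiple of the preceding one, because it is
the adjoint of the up operator and the chains form an orthogonal basis. -/
theorem exists_down_vec {c : Chain F n} (hc : c ∈ chains F n) (u : ℕ) :
    ∃ α : ℂ, down F n (c.vec u) = α • c.vec (u - 1) ∧ (u ≤ c.start → α = 0) := by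
  have hJ := isJordan_of_mem_chains hc
  have key : ∀ w : V F n, (∀ c' ∈ chains F n, ∀ l, c'.start ≤ l →
      stdInner (c'.vec (l + 1)) (c.vec u) = stdInner (c'.vec l) w) → down F n (c.vec u) = w := by
    intro w hw
    rw [← sub_eq_zero]
    refine eq_zero_of_stdInner_eq_zero (span_Jq n) ?_
    rintro _ ⟨c', hc', l, hl, -, rfl⟩
    obtain ⟨j, rfl⟩ := Nat.exists_eq_add_of_le hl
    rw [sub_eq_add_neg, ← neg_one_smul ℂ w, stdInner_add_right, stdInner_smul_right,
      ← stdInner_up_left, (isJordan_of_mem_chains hc').up_vec, hw c' hc' _ hl]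
    ring
  by_cases hu : c.start < u
  · obtain ⟨k, rfl⟩ : ∃ k, u = k + 1 := ⟨u - 1, by omega⟩
    refine ⟨stdInner (c.vec (k + 1)) (c.vec (k + 1)) / stdInner (c.vec k) (c.vec k),
      key _ fun c' hc' l hl => ?_, fun h => by omega⟩
    rw [stdInner_smul_right, Nat.add_sub_cancel]
    by_cases h : c' ≠ c ∨ l ≠ k
    · rw [stdInner_vec_vec hc' hc h, mul_zero]
      exact stdInner_vec_vec hc' hc (h.imp_right fun h h' => h (Nat.succ_injective h'))
    · push Not at h
      obtain ⟨rfl, rfl⟩ := h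
      by_cases h0 : c'.vec l = 0
      · -- both sides vanish, as the next vector of the chain is zero too
        obtain ⟨j, rfl⟩ := Nat.exists_eq_add_of_le hl
        rw [h0, ← hJ.up_vec, h0]
        simp
      · rw [div_mul_cancel₀ _ (mt stdInner_self_eq_zero.1 h0)]
  · refine ⟨0, key _ fun c' hc' l hl => ?_, fun _ => rfl⟩
    rw [zero_smul, stdInner_zero_right]
    refine stdInner_vec_vec hc' hc ?_
    by_cases h : c' = c
    · subst h
      exact Or.inr (by omega)
    · exact Or.inl h

theorem exists_down_pow_vec {c : Chain F n} (hc : c ∈ chains F n) (r u : ℕ) :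
    ∃ α : ℂ, (down F n ^ r) (c.vec u) = α • c.vec (u - r) ∧ (u < c.start + r → α = 0) := by
  induction r with
  | zero =>
    by_cases hu : c.start ≤ u
    · exact ⟨1, by simp, fun h => by omega⟩
    · exact ⟨0, by simp [(isJordan_of_mem_chains hc).eq_zero u (by omega)], fun _ => rfl⟩
  | succ r ih =>
    obtain ⟨α, h1, h2⟩ := ih
    obtain ⟨β, h3, h4⟩ := exists_down_vec hc (u - r)
    refine ⟨α * β, ?_, fun h => ?_⟩
    · rw [pow_succ', Module.End.mul_apply, h1, map_smul, h3, smul_smul, Nat.sub_sub]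
    · by_cases h5 : u < c.start + r
      · rw [h2 h5, zero_mul]
      · rw [h4 (by omega), mul_zero]

theorem IsJordan.up_pow_vec {c : Chain F n} (hc : IsJordan c) (r j : ℕ) :
    (up F n ^ r) (c.vec (c.start + j)) = c.vec (c.start + j + r) := by
  induction r with
  | zero => rfl
  | succ r ih =>
    rw [pow_succ', Module.End.mul_apply, ih, add_assoc c.start j r, hc.up_vec]
    congr 1
    omega

theorem exists_up_pow_down_pow {v : V F n} (hv : v ∈ Jq F n) (r : ℕ) :
    ∃ α : ℂ, (up F n ^ r) ((down F n ^ r) v) = α • v := by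
  obtain ⟨c, hc, u, hu, -, rfl⟩ := hv
  obtain ⟨α, h1, h2⟩ := exists_down_pow_vec hc r u
  by_cases h : u < c.start + r
  · exact ⟨0, by rw [h1, h2 h]; simp⟩
  · obtain ⟨j, rfl⟩ : ∃ j, u = c.start + j + r := ⟨u - r - c.start, by omega⟩
    exact ⟨α, by
      rw [h1, map_smul, Nat.add_sub_cancel, (isJordan_of_mem_chains hc).up_pow_vec]⟩

end Powers

/-! ### The vectors of a given rank -/

section Rank

variable {n m : ℕ}

variable (F n m) in
/-- The projection of `V(B_q(n))` to `V(B_q(n)_m)`. -/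
def rankProj : V F n →ₗ[ℂ] VRank F n m :=
  Finsupp.lsubtypeDomain {X : Bq F n | finrank F X = m}

theorem rankProj_apply (v : V F n) (X : BqRank F n m) : rankProj F n m v X = v X.1 := rfl

theorem rankIncl_single (X : BqRank F n m) (a : ℂ) :
    rankIncl F n m (Finsupp.single X a) = Finsupp.single X.1 a :=
  Finsupp.mapDomain_single

theorem rankIncl_apply (v : VRank F n m) (X : BqRank F n m) : rankIncl F n m v X.1 = v X :=
  Finsupp.mapDomain_apply Subtype.val_injective v X

theorem rankProj_rankIncl (v : VRank F n m) : rankProj F n m (rankIncl F n m v) = v := by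
  ext X
  rw [rankProj_apply, rankIncl_apply]

theorem rankIncl_rankProj {v : V F n} (hv : v ∈ graded F n m) :
    rankIncl F n m (rankProj F n m v) = v := by
  ext X
  by_cases hX : finrank F X = m
  · exact rankIncl_apply (rankProj F n m v) ⟨X, hX⟩
  · have h0 : v X = 0 := by
      by_contra h
      exact hX (mem_graded.1 hv X h)
    rw [h0]
    refine Finsupp.mapDomain_of_notMem_range _ _ ?_
    rintro ⟨Y, rfl⟩
    exact hX Y.2

theorem rankProj_eq_zero {u : ℕ} (hu : u ≠ m) {v : V F n} (hv : v ∈ graded F n u) :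
    rankProj F n m v = 0 := by
  ext X
  rw [rankProj_apply, Finsupp.zero_apply]
  by_contra h
  exact hu ((mem_graded.1 hv X.1 h).symm.trans X.2)

theorem stdInner_rankIncl (v w : VRank F n m) :
    stdInner (rankIncl F n m v) (rankIncl F n m w) = stdInner v w := by
  classical
  have h := stdInner_map_map (rankIncl F n m) (rankIncl F n m) (fun _ => 1) (fun X Y => ?_) 1 v w
    fun _ _ => rfl
  · rw [h, one_mul]
  · simp only [rankIncl_single, stdInner_single_left, Finsupp.single_apply, Subtype.ext_iff]
    simp [eq_comm]

theorem ne_zero_of_mem_JqRank {v : VRank F n m} (hv : v ∈ JqRank F n m) : v ≠ 0 := by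
  rintro rfl
  obtain ⟨c, hc, u, h1, h2, h⟩ := hv
  exact (isJordan_of_mem_chains hc).vec_ne_zero h1 h2 (by rw [← h, map_zero])

theorem pairwise_JqRank (n m : ℕ) :
    (JqRank F n m).Pairwise fun v w => stdInner v w = 0 := by
  rintro v ⟨c, hc, u, -, -, hv⟩ w ⟨c', hc', u', -, -, hw⟩ hne
  rw [← stdInner_rankIncl, hv, hw]
  refine stdInner_vec_vec hc hc' ?_
  by_contra h
  push Not at h
  obtain ⟨rfl, rfl⟩ := h
  rw [← rankProj_rankIncl v, ← rankProj_rankIncl w, hv, hw] at hne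
  exact hne rfl

theorem span_JqRank (n m : ℕ) : Submodule.span ℂ (JqRank F n m) = ⊤ := by
  have h : Submodule.span ℂ (Jq F n) ≤ (Submodule.span ℂ (JqRank F n m)).comap
      (rankProj F n m) := by
    rw [Submodule.span_le]
    rintro v hv
    obtain ⟨c, hc, u, -, -, h⟩ := id hv
    have hg := (isJordan_of_mem_chains hc).mem_graded u
    rw [← h] at hg
    by_cases hu : u = m
    · subst hu
      refine Submodule.subset_span ?_
      change rankIncl F n u (rankProj F n u v) ∈ Jq F n
      rwa [rankIncl_rankProj hg]
    · change rankProj F n m v ∈ Submodule.span ℂ (JqRank F n m)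
      rw [rankProj_eq_zero hu hg]
      exact Submodule.zero_mem _
  rw [eq_top_iff]
  intro v _
  rw [← rankProj_rankIncl v]
  exact h (span_Jq (F := F) n ▸ Submodule.mem_top)

variable (F n m) in
/-- The operator `U ^ r D ^ r` on `V(B_q(n)_m)`. -/
def upDown (r : ℕ) : Module.End ℂ (VRank F n m) :=
  rankProj F n m ∘ₗ (up F n ^ r) ∘ₗ (down F n ^ r) ∘ₗ rankIncl F n m

theorem upDown_single_apply (r : ℕ) (X Y : BqRank F n m) :
    upDown F n m r (Finsupp.single X 1) Y = ∑ Z, starRingEnd ℂ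
      ((down F n ^ r) (Finsupp.single Y.1 1) Z) * (down F n ^ r) (Finsupp.single X.1 1) Z := by
  rw [← stdInner_eq_sum, ← stdInner_up_pow_right, stdInner_single_left, map_one, one_mul,
    ← rankIncl_single]
  rfl

theorem upDown_mem_commutant (r : ℕ) : upDown F n m r ∈ commutant F n m := by
  rw [mem_commutant_iff]
  intro g X Y
  let e := LinearEquiv.ofBijective (g : Matrix (Fin n) (Fin n) F).mulVecLin
    ⟨mulVecLin_injective g, LinearMap.surjective_of_injective (mulVecLin_injective g)⟩
  have he : ∀ P : BqRank F n m, (g • P).1 = P.1.map e.toLinearMap := fun P => rfl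
  rw [upDown_single_apply, upDown_single_apply]
  refine (Fintype.sum_equiv (Submodule.orderIsoMapComap e).toEquiv _ _ fun Z => ?_).symm
  change _ = starRingEnd ℂ ((down F n ^ r) (Finsupp.single (g • Y).1 1) (Z.map e.toLinearMap)) *
    (down F n ^ r) (Finsupp.single (g • X).1 1) (Z.map e.toLinearMap)
  rw [he, he, down_pow_single_map, down_pow_single_map]

/-- The matrix of `U ^ r D ^ r` is triangular with respect to the association matrices: its entries
vanish on pairs with `dim (X ∩ Y) < m - r`, and not on those with `dim (X ∩ Y) = m - r`. -/
theorem upDown_single_apply_ne_zero {r : ℕ} {X Y : BqRank F n m} :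
    (finrank F ↥(X.1 ⊓ Y.1) + r < m → upDown F n m r (Finsupp.single X 1) Y = 0) ∧
    (finrank F ↥(X.1 ⊓ Y.1) + r = m → upDown F n m r (Finsupp.single X 1) Y ≠ 0) := by
  choose c hc hc' using fun P : Bq F n => exists_down_pow_single_apply r P
  have hentry : upDown F n m r (Finsupp.single X 1) Y =
      ((∑ Z, c Y.1 Z * c X.1 Z : ℕ) : ℂ) := by
    rw [upDown_single_apply]
    push_cast
    exact Finset.sum_congr rfl fun Z _ => by rw [hc, hc, map_natCast]
  have hne : ∀ Z, c Y.1 Z * c X.1 Z ≠ 0 ↔ Z ≤ X.1 ⊓ Y.1 ∧ finrank F Z + r = m := by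
    intro Z
    rw [mul_ne_zero_iff, hc', hc', X.2, Y.2, le_inf_iff]
    tauto
  rw [hentry]
  constructor
  · intro h
    rw [Nat.cast_eq_zero]
    refine Finset.sum_eq_zero fun Z _ => ?_
    by_contra hZ
    obtain ⟨h1, h2⟩ := (hne Z).1 hZ
    have := Submodule.finrank_mono h1
    omega
  · intro h
    rw [Nat.cast_ne_zero, Ne, Finset.sum_eq_zero_iff]
    push Not
    exact ⟨X.1 ⊓ Y.1, Finset.mem_univ _, (hne _).2 ⟨le_rfl, h⟩⟩

theorem assocMap_eq_zero {i : ℕ}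
    (h : ¬ ∃ X Y : BqRank F n m, finrank F ↥(X.1 ⊓ Y.1) + i = m) : assocMap F n m i = 0 := by
  classical
  refine Finsupp.lhom_ext' fun X => LinearMap.ext_ring (Finsupp.ext fun Y => ?_)
  change assocMap F n m i (Finsupp.single X 1) Y = 0
  rw [assocMap_single_apply, if_neg fun h' => h ⟨X, Y, h'⟩]

theorem exists_assocMap_apply_eq {v : VRank F n m} (hv : v ∈ JqRank F n m) (r : ℕ) (hr : r ≤ m) :
    ∃ α : ℂ, assocMap F n m r v = α • v := by
  induction r using Nat.strong_induction_on with
  | _ r ih =>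
    by_cases hex : ∃ X Y : BqRank F n m, finrank F ↥(X.1 ⊓ Y.1) + r = m
    swap
    · exact ⟨0, by rw [assocMap_eq_zero hex]; simp⟩
    obtain ⟨t, ht⟩ := exists_entry_of_mem_commutant (upDown_mem_commutant (F := F) (n := n)
      (m := m) r)
    obtain ⟨β, hβ⟩ := exists_up_pow_down_pow hv r
    have h1 : upDown F n m r v = β • v := by
      change rankProj F n m ((up F n ^ r) ((down F n ^ r) (rankIncl F n m v))) = _
      rw [hβ, map_smul, rankProj_rankIncl]
    have htr : t (m - r) ≠ 0 := by
      obtain ⟨X, Y, hXY⟩ := hex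
      have := upDown_single_apply_ne_zero.2 hXY
      rwa [ht, show finrank F ↥(X.1 ⊓ Y.1) = m - r by omega] at this
    have hgt : ∀ i, r < i → t (m - i) • assocMap F n m i = 0 := by
      intro i hi
      by_cases hex' : ∃ X Y : BqRank F n m, finrank F ↥(X.1 ⊓ Y.1) + i = m
      · obtain ⟨X, Y, hXY⟩ := hex'
        have := (upDown_single_apply_ne_zero (r := r) (X := X) (Y := Y)).1 (by omega)
        rw [ht, show finrank F ↥(X.1 ⊓ Y.1) = m - i by omega] at this
        rw [this, zero_smul]
      · rw [assocMap_eq_zero hex', smul_zero]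
    have h2 : β • v = ∑ i ∈ Finset.range r, t (m - i) • assocMap F n m i v +
        t (m - r) • assocMap F n m r v := by
      rw [← h1, eq_sum_assocMap ht, LinearMap.sum_apply, ← Finset.sum_range_succ]
      refine (Finset.sum_subset (Finset.range_subset_range.2 (by omega)) fun i _ hi => ?_).symm
      rw [LinearMap.smul_apply, ← LinearMap.smul_apply, hgt i (by simpa using hi)]
      rfl
    choose! α hα using ih
    have h3 : ∑ i ∈ Finset.range r, t (m - i) • assocMap F n m i v =
        (∑ i ∈ Finset.range r, t (m - i) * α i) • v := by
      rw [Finset.sum_smul]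
      refine Finset.sum_congr rfl fun i hi => ?_
      have hi' := Finset.mem_range.1 hi
      rw [hα i hi' (by omega), smul_smul]
    rw [h3] at h2
    refine ⟨(t (m - r))⁻¹ * (β - ∑ i ∈ Finset.range r, t (m - i) * α i), ?_⟩
    rw [mul_smul, sub_smul, h2, add_sub_cancel_left, inv_smul_smul₀ htr]

theorem hasEigenvector_of_mem_JqRank {T : Module.End ℂ (VRank F n m)} (hT : T ∈ commutant F n m)
    {v : VRank F n m} (hv : v ∈ JqRank F n m) : ∃ c : ℂ, Module.End.HasEigenvector T c v := by
  suffices ∃ c : ℂ, T v = c • v by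
    obtain ⟨c, hc⟩ := this
    exact ⟨c, Module.End.mem_eigenspace_iff.2 hc, ne_zero_of_mem_JqRank hv⟩
  rw [← Subalgebra.mem_toSubmodule, toSubmodule_commutant] at hT
  induction hT using Submodule.span_induction with
  | mem A hA =>
    obtain ⟨i, hi, rfl⟩ := hA
    exact exists_assocMap_apply_eq hv i hi
  | zero => exact ⟨0, by simp⟩
  | add A B _ _ hA hB =>
    obtain ⟨a, ha⟩ := hA
    obtain ⟨b, hb⟩ := hB
    exact ⟨a + b, by rw [LinearMap.add_apply, ha, hb, add_smul]⟩
  | smul a A _ hA =>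
    obtain ⟨b, hb⟩ := hA
    exact ⟨a * b, by rw [LinearMap.smul_apply, hb, smul_smul]⟩

end Rank

end

end Grassmann

theorem mainTheorem5 (F : Type*) [Field F] [Fintype F] (n m : ℕ) (hm : 2 * m ≤ n) :
    -- the elements of `J_q(n, m)` are pairwise orthogonal
    (Grassmann.JqRank F n m).Pairwise (fun v w => Grassmann.stdInner v w = 0) ∧
    -- `J_q(n, m)` is a basis of `V(B_q(n)_m)`
    LinearIndepOn ℂ id (Grassmann.JqRank F n m) ∧
    Submodule.span ℂ (Grassmann.JqRank F n m) = ⊤ ∧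
    -- each of its elements is an eigenvector of every element of the commutant of `GL(n, q)`
    (∀ T ∈ Grassmann.commutant F n m, ∀ v ∈ Grassmann.JqRank F n m,
      ∃ c : ℂ, Module.End.HasEigenvector T c v) ∧
    -- the commutant is the Bose-Mesner algebra of the Grassmann scheme
    Subalgebra.toSubmodule (Grassmann.commutant F n m) = Grassmann.boseMesner F n m :=
  ⟨Grassmann.pairwise_JqRank n m,
    Grassmann.linearIndepOn_of_pairwise_stdInner (Grassmann.pairwise_JqRank n m) fun _ =>
      Grassmann.ne_zero_of_mem_JqRank,
    Grassmann.span_JqRank n m,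
    fun _ hT _ hv => Grassmann.hasEigenvector_of_mem_JqRank hT hv,
    Grassmann.toSubmodule_commutant n m⟩
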